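/- In Capacity-Constrained Facility Location (CCFL) there are $m\ge 2$ facilities with opening costs $c_1,\dots,c_m\in[0,\infty]$ that are known up-front, and clients $1,\dots,n$ arrive one at a time, their number $n$ not being known in advance. On arrival, client $j$ reveals for every facility $i$ an assignment cost $a_{ij}\in[0,\infty]$ and a load $p_{ij}\in[0,\infty]$ (the value $\infty$ forbids the assignment). The algorithm may then open further facilities and must assign $j$ to a facility $\sigma(j)$ that is open; opening and assignment decisions are irrevocable. If $F$ is the set of opened facilities at the end, the cost is $$\sum_{i\in F}c_i+\sum_{j=1}^n a_{\sigma(j)j}+\max_{1\le i\le m}\ \sum_{j:\sigma(j)=i}p_{ij},$$ i.e. the sum of opening costs, assignment costs and makespan. (Facility capacities do not enter the objective; loads relative to capacities $u_i>0$ are the case in which $p_{ij}$ is already divided by $u_i$.) Let $\mathrm{OPT}$ be the minimum cost of an offline solution, i.e. the minimum of this cost over all $F\subseteq\{1,\dots,m\}$ and $\sigma:\{1,\dots,n\}\to F$. A randomized online algorithm is a probability distribution over deterministic online algorithms. Theorem. There is a randomized $O(\log^2 m\cdot\log(mn))$-competitive online algorithm for CCFL: there is an absolute constant $C>0$ such that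 for every $m\ge2$ there is a randomized online algorithm for CCFL with $m$ facilities which, on every instance with $m$ facilities and any number $n$ of clients (fixed independently of the algorithm's random choices), has expected cost at most $C\cdot\log^2 m\cdot\log(mn)\cdot\mathrm{OPT}$. (For $n=0$ both sides are $0$.) -/

import Mathlib

open scoped ENNReal

namespace CCFL

/-- What a client reveals on arrival in an instance with `m` facilities: for each facility `i`,
the cost of assigning the client to `i` and the load that it puts on `i`.
The value `∞` forbids the assignment. -/
structure Client (m : ℕ) where
  assignCost : Fin m → ℝ≥0∞
  load : Fin m → ℝ≥0∞

/-- The objective value of the solution that opens the facilities in `F` and assigns client `j` to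
facility `σ j`: opening costs plus assignment costs plus makespan (maximum load of a facility). -/
noncomputable def cost {m n : ℕ} (openCost : Fin m → ℝ≥0∞) (client : Fin n → Client m)
    (F : Finset (Fin m)) (σ : Fin n → Fin m) : ℝ≥0∞ :=
  ∑ i ∈ F, openCost i + ∑ j, (client j).assignCost (σ j)
    + ⨆ i : Fin m, ∑ j with σ j = i, (client j).load i

/-- The offline optimum: the least cost of a solution that assigns every client to an open
facility. -/
noncomputable def opt {m n : ℕ} (openCost : Fin m → ℝ≥0∞) (client : Fin n → Client m) : ℝ≥0∞ :=
  ⨅ (F : Finset (Fin m)) (σ : Fin n → Fin m) (_ : ∀ j, σ j ∈ F), cost openCost client F σ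

/-- The clients `0, …, j` of a sequence, i.e. everything that has arrived when client `j` has to be
served. -/
def upTo {m n : ℕ} (client : Fin n → Client m) (j : Fin n) : Fin (j.val + 1) → Client m :=
  fun l => client (l.castLE j.isLt)

/-- A deterministic online algorithm for instances with `m` facilities. It knows the opening costs
in advance, but not the number of clients. When client number `k` (counting from `0`) arrives, it
sees the clients `0, …, k`, opens the (possibly empty) set of facilities
`opens openCost k client`, and assigns client `k` to the facility `assign openCost k client`,
which must have been opened in this or an earlier step. Decisions are never revoked. -/
structure OnlineAlgorithm (m : ℕ) where
  opens : (Fin m → ℝ≥0∞) → (k : ℕ) → (Fin (k + 1) → Client m) → Finset (Fin m)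
  assign : (Fin m → ℝ≥0∞) → (k : ℕ) → (Fin (k + 1) → Client m) → Fin m
  assign_open : ∀ (openCost : Fin m → ℝ≥0∞) (k : ℕ) (client : Fin (k + 1) → Client m),
    ∃ j : Fin (k + 1), assign openCost k client ∈ opens openCost j.val (upTo client j)

namespace OnlineAlgorithm

/-- All facilities that the algorithm has opened at the end of the client sequence. -/
def openedSet {m n : ℕ} (A : OnlineAlgorithm m) (openCost : Fin m → ℝ≥0∞)
    (client : Fin n → Client m) : Finset (Fin m) :=
  Finset.univ.biUnion fun j : Fin n => A.opens openCost j.val (upTo client j)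

/-- The facility to which the algorithm assigns client `j`. -/
def assignment {m n : ℕ} (A : OnlineAlgorithm m) (openCost : Fin m → ℝ≥0∞)
    (client : Fin n → Client m) (j : Fin n) : Fin m :=
  A.assign openCost j.val (upTo client j)

/-- The cost of the solution computed by the algorithm. -/
noncomputable def algCost {m n : ℕ} (A : OnlineAlgorithm m) (openCost : Fin m → ℝ≥0∞)
    (client : Fin n → Client m) : ℝ≥0∞ :=
  cost openCost client (A.openedSet openCost client) (A.assignment openCost client)

end OnlineAlgorithm

/-- A randomized online algorithm for instances with `m` facilities: a random deterministic online
algorithm, drawn from a probability space before the first client arrives, all of whose decisions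
are random variables. -/
structure RandomizedOnlineAlgorithm (m : ℕ) where
  Ω : Type
  [measurableSpace : MeasurableSpace Ω]
  μ : MeasureTheory.Measure Ω
  [isProbabilityMeasure : MeasureTheory.IsProbabilityMeasure μ]
  alg : Ω → OnlineAlgorithm m
  measurableSet_opens : ∀ (openCost : Fin m → ℝ≥0∞) (k : ℕ) (client : Fin (k + 1) → Client m)
    (i : Fin m), MeasurableSet {ω | i ∈ (alg ω).opens openCost k client}
  measurableSet_assign : ∀ (openCost : Fin m → ℝ≥0∞) (k : ℕ) (client : Fin (k + 1) → Client m)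
    (i : Fin m), MeasurableSet {ω | (alg ω).assign openCost k client = i}

attribute [instance] RandomizedOnlineAlgorithm.measurableSpace
  RandomizedOnlineAlgorithm.isProbabilityMeasure

/-- The expected cost of a randomized online algorithm on a fixed instance. -/
noncomputable def RandomizedOnlineAlgorithm.expectedCost {m n : ℕ}
    (A : RandomizedOnlineAlgorithm m) (openCost : Fin m → ℝ≥0∞) (client : Fin n → Client m) :
    ℝ≥0∞ :=
  ∫⁻ ω, (A.alg ω).algCost openCost client ∂A.μ

end CCFL

open scoped ENNReal

namespace CCFL

open Filter Topology

/-! Guess the optimum, run multiplicative weights for each guess, and round with one random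
threshold per facility. The guess Z for a client is the prefix optimum rounded up to a power of two.
Clients with equal guesses form one phase, with costs divided by Z. Guesses are at most 2·OPT and
distinct ones differ by a factor of at least 2, so they sum to at most 4·OPT
(`sum_le_two_mul_of_doubling`); it suffices to charge each phase a multiple of Z.

In a phase, facility i has normalised cost c_i and a weight w_i starting at 1/m. Serving a client by
i is priced at a_i + c_i·max(1, w_i)·p_i/4. A level α rises, with weights of facilities priced below
α growing by exp((α - price)/c_i), until facilities priced at most α have total weight at least 1. A
set S of servers is chosen among these, and their weights gain a further factor exp(p_i/8)
(`exists_weightStep`). The potential Φ = ∑ c_i w_i grows by at most 3α. Conversely, evaluating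
prices along an offline solution within the budget gives ∑ α ≤ O(log m) + Φ/4. As 3/4 < 1, both Φ
and ∑ α are O(log m) (`Phase.potential_bound`, `Phase.price_bound`). Weights start at 1/m and stay
polynomial in m, so the factors exp(p_i/8) bound by O(log m) the total load on i of all clients
having i as a server (`Phase.load_bound`).

Client k opens its servers i with θ_i < 2 log(m(k+1))·w_i, where the θ_i are uniform and drawn in
advance. A phase then has expected opening cost O(log(mn))·Φ·Z, while assignment and load bounds
hold whichever server is used. No server is open with probability at most 1/(k+1)², so the fallback
costs sum to O(OPT). The total is O(log m · log(mn))·OPT, and the remaining factor log m is slack.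
-/

/-! ### Price and weight update for a single client -/

/-- As the level passes b i, the sum jumps by w i. At the supremum of the admissible levels, the
strict filter gives the left limit and the non-strict filter the right limit. -/
theorem exists_threshold {ι : Type*} (E : Finset ι) (hE : E.Nonempty) (c w b : ι → ℝ)
    (hc : ∀ i, 0 < c i) (hw : ∀ i, 0 < w i) (hb : ∀ i ∈ E, 0 ≤ b i) :
    ∃ α : ℝ, 0 ≤ α ∧
      ∑ i ∈ E with b i < α, w i * Real.exp ((α - b i) / c i) ≤ 1 ∧
      1 ≤ ∑ i ∈ E with b i ≤ α, w i * Real.exp ((α - b i) / c i) := by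
  set D : Set ℝ := {α | 0 ≤ α ∧ ∑ i ∈ E with b i < α, w i * Real.exp ((α - b i) / c i) ≤ 1}
    with hD
  have hterm : ∀ (x : ℝ) (i : ι), 0 ≤ w i * Real.exp ((x - b i) / c i) := fun x i =>
    mul_nonneg (hw i).le (Real.exp_pos _).le
  have h0 : (0 : ℝ) ∈ D := by
    refine ⟨le_rfl, ?_⟩
    rw [Finset.filter_false_of_mem (fun i hi => not_lt.2 (hb i hi))]
    simp
  obtain ⟨i₀, hi₀⟩ := hE
  have hbdd : BddAbove D := by
    -- Beyond this level the term of i₀ alone exceeds 1, by exp x ≥ x + 1.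
    refine ⟨b i₀ + c i₀ / w i₀, fun α hα => ?_⟩
    by_contra! hlt
    have hpos : 0 < c i₀ / w i₀ := div_pos (hc _) (hw _)
    have h1 : w i₀ * Real.exp ((α - b i₀) / c i₀) ≤ 1 :=
      (Finset.single_le_sum (f := fun i => w i * Real.exp ((α - b i) / c i))
        (fun i _ => hterm α i) (Finset.mem_filter.2 ⟨hi₀, by linarith⟩)).trans hα.2
    have h2 : 1 / w i₀ < (α - b i₀) / c i₀ := by
      rw [lt_div_iff₀ (hc _)]
      calc 1 / w i₀ * c i₀ = c i₀ / w i₀ := by ring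
        _ < _ := by linarith
    have h3 := Real.add_one_le_exp ((α - b i₀) / c i₀)
    have h4 : w i₀ * (1 / w i₀) < w i₀ * Real.exp ((α - b i₀) / c i₀) :=
      mul_lt_mul_of_pos_left (by linarith) (hw _)
    rw [mul_one_div_cancel (hw _).ne'] at h4
    linarith
  have hcont : ∀ T : Finset ι,
      Continuous fun x : ℝ => ∑ i ∈ T, w i * Real.exp ((x - b i) / c i) := fun T => by
    fun_prop
  have hcl := csSup_mem_closure ⟨0, h0⟩ hbdd
  set α := sSup D
  refine ⟨α, le_csSup hbdd h0, ?_, ?_⟩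
  · by_contra! hgt
    have e1 : ∀ᶠ x in 𝓝 α,
        1 < ∑ i ∈ E with b i < α, w i * Real.exp ((x - b i) / c i) :=
      (hcont _).continuousAt.eventually (lt_mem_nhds hgt)
    have e2 : ∀ᶠ x in 𝓝 α, ∀ i ∈ E.filter (fun i => b i < α), b i < x :=
      (Filter.eventually_all_finset _).2 fun i hi =>
        lt_mem_nhds (Finset.mem_filter.1 hi).2
    obtain ⟨x, hxD, hx1, hx2⟩ := ((mem_closure_iff_frequently.1 hcl).and_eventually
      (e1.and e2)).exists
    have : ∑ i ∈ E with b i < α, w i * Real.exp ((x - b i) / c i)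
        ≤ ∑ i ∈ E with b i < x, w i * Real.exp ((x - b i) / c i) :=
      Finset.sum_le_sum_of_subset_of_nonneg
        (fun i hi => Finset.mem_filter.2 ⟨(Finset.mem_filter.1 hi).1, hx2 i hi⟩)
        (fun i _ _ => hterm x i)
    linarith [hxD.2]
  · by_contra! hlt
    have e1 : ∀ᶠ x in 𝓝 α,
        ∑ i ∈ E with b i ≤ α, w i * Real.exp ((x - b i) / c i) < 1 :=
      (hcont _).continuousAt.eventually (gt_mem_nhds hlt)
    have e2 : ∀ᶠ x in 𝓝 α, ∀ i ∈ E.filter (fun i => α < b i), x < b i :=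
      (Filter.eventually_all_finset _).2 fun i hi =>
        gt_mem_nhds (Finset.mem_filter.1 hi).2
    have e3 : ∀ᶠ x in 𝓝[>] α, α < x := eventually_mem_nhdsWithin
    obtain ⟨x, ⟨hx1, hx2⟩, hx3⟩ :=
      (((e1.and e2).filter_mono nhdsWithin_le_nhds).and e3).exists
    have hle : ∑ i ∈ E with b i < x, w i * Real.exp ((x - b i) / c i)
        ≤ ∑ i ∈ E with b i ≤ α, w i * Real.exp ((x - b i) / c i) := by
      refine Finset.sum_le_sum_of_subset_of_nonneg (fun i hi => ?_) (fun i _ _ => hterm x i)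
      rw [Finset.mem_filter] at hi ⊢
      refine ⟨hi.1, ?_⟩
      by_contra! hcon
      exact absurd (hx2 i (Finset.mem_filter.2 ⟨hi.1, hcon⟩)) (not_lt.2 hi.2.le)
    have hxD : x ∈ D := ⟨(le_csSup hbdd h0).trans hx3.le, hle.trans hx1.le⟩
    exact absurd (le_csSup hbdd hxD) (not_le.2 hx3)

/-- Adding terms one by one, the first partial sum to reach 1 overshoots by at most one term. -/
theorem exists_subset_sum_mem_Icc {ι : Type*} (U : Finset ι) (f : ι → ℝ) (hf : ∀ i, f i ≤ 1)
    (hU : 1 ≤ ∑ i ∈ U, f i) : ∃ S ⊆ U, 1 ≤ ∑ i ∈ S, f i ∧ ∑ i ∈ S, f i ≤ 2 := by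
  classical
  induction U using Finset.induction_on with
  | empty => norm_num at hU
  | insert a s ha ih =>
    by_cases hs : 1 ≤ ∑ i ∈ s, f i
    · obtain ⟨S, hS, h⟩ := ih hs
      exact ⟨S, hS.trans (Finset.subset_insert _ _), h⟩
    · refine ⟨insert a s, subset_rfl, hU, ?_⟩
      rw [Finset.sum_insert ha]
      linarith [hf a]

theorem one_le_sum_min_one {ι : Type*} (U : Finset ι) (f : ι → ℝ) (hf : ∀ i, 0 ≤ f i)
    (hU : 1 ≤ ∑ i ∈ U, f i) : 1 ≤ ∑ i ∈ U, min 1 (f i) := by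
  by_cases h : ∃ i ∈ U, 1 ≤ f i
  · obtain ⟨i, hi, h1⟩ := h
    calc (1 : ℝ) = min 1 (f i) := (min_eq_left h1).symm
      _ ≤ _ := Finset.single_le_sum (f := fun i => min 1 (f i))
        (fun j _ => le_min zero_le_one (hf j)) hi
  · push Not at h
    rwa [Finset.sum_congr rfl fun i hi => min_eq_right (h i hi).le]

/-- One update of the facility weights `w` to `w'`, for a client with price `α` that may be served
by the facilities in `S`. -/
structure WeightStep {ι : Type*} (E : Finset ι) (c a p w : ι → ℝ) (α : ℝ) (S : Finset ι)
    (w' : ι → ℝ) : Prop where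
  nonneg : 0 ≤ α
  subset : S ⊆ E
  le : ∀ i, w i ≤ w' i
  eq_of_notMem : ∀ i, i ∉ E → w' i = w i
  price_le : ∀ i ∈ E, α ≤ a i + c i * max 1 (w i) * p i / 4
    + c i * (Real.log (min 1 (w' i)) - Real.log (min 1 (w i)))
  potential_le : ∑ i ∈ E, c i * (w' i - w i) ≤ 3 * α
  assign_le : ∀ i ∈ S, a i ≤ α
  mul_exp_le : ∀ i ∈ S, w i * Real.exp (p i / 8) ≤ w' i
  covers : 1 ≤ ∑ i ∈ S, w' i

theorem exists_weightStep {ι : Type*} (E : Finset ι) (hE : E.Nonempty) (c a p w : ι → ℝ)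
    (hc : ∀ i, 0 < c i) (hw : ∀ i, 0 < w i) (ha : ∀ i ∈ E, 0 ≤ a i)
    (hp : ∀ i ∈ E, 0 ≤ p i ∧ p i ≤ 1) :
    ∃ (α : ℝ) (S : Finset ι) (w' : ι → ℝ), WeightStep E c a p w α S w' := by
  classical
  set b : ι → ℝ := fun i => a i + c i * max 1 (w i) * p i / 4 with hbdef
  have hmul : ∀ i ∈ E, 0 ≤ c i * max 1 (w i) * p i / 4 := fun i hi => by
    have := (hp i hi).1
    have := hc i
    positivity
  have hb : ∀ i ∈ E, 0 ≤ b i := fun i hi => add_nonneg (ha i hi) (hmul i hi)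
  obtain ⟨α, hα, h1, h2⟩ := exists_threshold E hE c w b hc hw hb
  set v : ι → ℝ := fun i => if i ∈ E ∧ b i < α then w i * Real.exp ((α - b i) / c i) else w i
    with hv
  have hvpos : ∀ i, 0 < v i := fun i => by
    simp only [hv]; split_ifs
    · exact mul_pos (hw i) (Real.exp_pos _)
    · exact hw i
  have hwv : ∀ i, w i ≤ v i := fun i => by
    simp only [hv]; split_ifs with h
    · exact le_mul_of_one_le_right (hw i).le
        (Real.one_le_exp (div_nonneg (by linarith [h.2]) (hc i).le))
    · exact le_rfl
  have hv1 : ∀ i, i ∈ E ∧ b i < α → v i ≤ 1 := fun i hi => by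
    have : v i = w i * Real.exp ((α - b i) / c i) := if_pos hi
    rw [this]
    exact (Finset.single_le_sum (f := fun i => w i * Real.exp ((α - b i) / c i))
        (fun i _ => mul_nonneg (hw i).le (Real.exp_pos _).le)
        (Finset.mem_filter.2 hi)).trans h1
  -- Only weights that remain at most 1 were raised, so the price factor is the same for v and w.
  have hmax : ∀ i, max 1 (v i) = max 1 (w i) := fun i => by
    by_cases hi : i ∈ E ∧ b i < α
    · rw [max_eq_left (hv1 i hi), max_eq_left ((hwv i).trans (hv1 i hi))]
    · have : v i = w i := if_neg hi
      rw [this]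
  have h2v : 1 ≤ ∑ i ∈ E with b i ≤ α, v i := by
    refine h2.trans (Finset.sum_le_sum fun i hi => ?_)
    rw [Finset.mem_filter] at hi
    rcases hi.2.lt_or_eq with h | h
    · exact (if_pos (c := i ∈ E ∧ b i < α) ⟨hi.1, h⟩).ge
    · rw [h, sub_self, zero_div, Real.exp_zero, mul_one]; exact hwv i
  obtain ⟨S, hS, hS1, hS2⟩ := exists_subset_sum_mem_Icc _ (fun i => min 1 (v i))
    (fun i => min_le_left _ _) (one_le_sum_min_one _ v (fun i => (hvpos i).le) h2v)
  have hSE : ∀ i ∈ S, i ∈ E := fun i hi => (Finset.mem_filter.1 (hS hi)).1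
  have hSb : ∀ i ∈ S, b i ≤ α := fun i hi => (Finset.mem_filter.1 (hS hi)).2
  set w' : ι → ℝ := fun i => if i ∈ S then v i * Real.exp (p i / 8) else v i with hw'
  have hvw' : ∀ i, v i ≤ w' i := fun i => by
    simp only [hw']; split_ifs with h
    · exact le_mul_of_one_le_right (hvpos i).le
        (Real.one_le_exp (div_nonneg (hp i (hSE i h)).1 (by norm_num)))
    · exact le_rfl
  refine ⟨α, S, w', hα, hSE, fun i => (hwv i).trans (hvw' i), ?_, ?_, ?_, ?_, ?_, ?_⟩
  · intro i hi
    have e1 : v i = w i := if_neg fun h => hi h.1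
    have e2 : w' i = v i := if_neg fun h => hi (hSE i h)
    rw [e2, e1]
  · intro i hi
    have hminpos : 0 < min 1 (w i) := lt_min one_pos (hw i)
    -- If b i < α, the raise has exponent (α - b i) / c i and ends at most at 1, so the truncated
    -- logarithm records all of it. Otherwise α ≤ b i already.
    by_cases hlt : b i < α
    · have e1 : v i = w i * Real.exp ((α - b i) / c i) := if_pos ⟨hi, hlt⟩
      have e2 : v i ≤ min 1 (w' i) := le_min (hv1 i ⟨hi, hlt⟩) (hvw' i)
      have e3 : Real.log (v i) ≤ Real.log (min 1 (w' i)) := Real.log_le_log (hvpos i) e2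
      have e4 : Real.log (min 1 (w i)) ≤ Real.log (w i) :=
        Real.log_le_log hminpos (min_le_right _ _)
      rw [e1, Real.log_mul (hw i).ne' (Real.exp_pos _).ne', Real.log_exp] at e3
      have e5 : c i * ((α - b i) / c i)
          ≤ c i * (Real.log (min 1 (w' i)) - Real.log (min 1 (w i))) :=
        mul_le_mul_of_nonneg_left (by linarith) (hc i).le
      rw [mul_div_cancel₀ _ (hc i).ne'] at e5
      have : b i = a i + c i * max 1 (w i) * p i / 4 := rfl
      linarith
    · have e3 : Real.log (min 1 (w i)) ≤ Real.log (min 1 (w' i)) :=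
        Real.log_le_log hminpos (min_le_min le_rfl ((hwv i).trans (hvw' i)))
      have := mul_nonneg (hc i).le (sub_nonneg.2 e3)
      have : b i = a i + c i * max 1 (w i) * p i / 4 := rfl
      linarith
  · have e1 : ∑ i ∈ E, c i * (v i - w i) ≤ α := by
      have : ∀ i ∈ E, c i * (v i - w i)
          ≤ if b i < α then α * (w i * Real.exp ((α - b i) / c i)) else 0 := by
        intro i hi
        split_ifs with h
        · have e1 : v i = w i * Real.exp ((α - b i) / c i) := if_pos ⟨hi, h⟩
          set s := (α - b i) / c i with hs
          have hs' : c i * s = α - b i := mul_div_cancel₀ _ (hc i).ne'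
          have h3 : Real.exp s - 1 ≤ s * Real.exp s := by
            have := Real.add_one_le_exp (-s)
            have h4 := mul_le_mul_of_nonneg_right this (Real.exp_pos s).le
            rw [← Real.exp_add, neg_add_cancel, Real.exp_zero] at h4
            linarith
          calc c i * (v i - w i) = (c i * w i) * (Real.exp s - 1) := by rw [e1]; ring
            _ ≤ (c i * w i) * (s * Real.exp s) :=
              mul_le_mul_of_nonneg_left h3 (mul_pos (hc i) (hw i)).le
            _ = (α - b i) * (w i * Real.exp s) := by rw [← hs']; ring
            _ ≤ α * (w i * Real.exp s) :=
              mul_le_mul_of_nonneg_right (by linarith [hb i hi])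
                (mul_pos (hw i) (Real.exp_pos _)).le
        · have e1 : v i = w i := if_neg fun h' => h h'.2
          rw [e1]; simp
      refine (Finset.sum_le_sum this).trans ?_
      rw [← Finset.sum_filter, ← Finset.mul_sum]
      exact mul_le_of_le_one_right hα h1
    have e2 : ∑ i ∈ E, c i * (w' i - v i) ≤ 2 * α := by
      have h3 : ∑ i ∈ E, c i * (w' i - v i) = ∑ i ∈ S, c i * (w' i - v i) := by
        refine (Finset.sum_subset hSE fun i _ hi => ?_).symm
        have : w' i = v i := if_neg hi
        rw [this]; simp
      rw [h3]
      have h4 : ∀ i ∈ S, c i * (w' i - v i) ≤ α * min 1 (v i) := by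
        intro i hi
        have e1 : w' i = v i * Real.exp (p i / 8) := if_pos hi
        have hpi := hp i (hSE i hi)
        have h5 : Real.exp (p i / 8) - 1 ≤ p i / 4 := by
          have h6 := Real.exp_bound_div_one_sub_of_interval (x := p i / 8)
            (by linarith) (by linarith)
          have h7 : 1 / (1 - p i / 8) ≤ 1 + p i / 4 := by
            rw [div_le_iff₀ (by linarith)]
            nlinarith
          linarith
        -- This splits the increase into the load part of the price, at most α, times the truncated
        -- weight.
        have h6 : max 1 (v i) * min 1 (v i) = v i := by
          rw [max_mul_min, one_mul]
        have h7 : c i * max 1 (w i) * p i / 4 ≤ b i := by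
          have := ha i (hSE i hi)
          simp only [hbdef]; linarith
        have h8 := hc i
        have h9 := hvpos i
        calc c i * (w' i - v i) = (c i * v i) * (Real.exp (p i / 8) - 1) := by rw [e1]; ring
          _ ≤ (c i * v i) * (p i / 4) := mul_le_mul_of_nonneg_left h5 (by positivity)
          _ = (c i * max 1 (w i) * p i / 4) * min 1 (v i) := by
            nth_rewrite 1 [← h6]; rw [hmax]; ring
          _ ≤ α * min 1 (v i) := mul_le_mul_of_nonneg_right (h7.trans (hSb i hi)) (by positivity)
      refine (Finset.sum_le_sum h4).trans ?_
      rw [← Finset.mul_sum]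
      nlinarith
    have e3 : ∑ i ∈ E, c i * (w' i - w i)
        = ∑ i ∈ E, c i * (v i - w i) + ∑ i ∈ E, c i * (w' i - v i) := by
      rw [← Finset.sum_add_distrib]
      exact Finset.sum_congr rfl fun i _ => by ring
    linarith
  · intro i hi
    have := hmul i (hSE i hi)
    have h3 := hSb i hi
    simp only [hbdef] at h3
    linarith
  · intro i hi
    have e1 : w' i = v i * Real.exp (p i / 8) := if_pos hi
    rw [e1]
    exact mul_le_mul_of_nonneg_right (hwv i) (Real.exp_pos _).le
  · exact hS1.trans (Finset.sum_le_sum fun i _ => (min_le_right _ _).trans (hvw' i))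

/-! ### Accounting over one phase -/

theorem sum_sub_eq_of_skip {n : ℕ} {T : Finset ℕ} (hT : T ⊆ Finset.range n) (f : ℕ → ℝ)
    (hf : ∀ k < n, k ∉ T → f (k + 1) = f k) : ∑ k ∈ T, (f (k + 1) - f k) = f n - f 0 := by
  rw [← Finset.sum_range_sub]
  refine Finset.sum_subset hT fun k hk hkT => ?_
  rw [hf k (Finset.mem_range.1 hk) hkT, sub_self]

/-- A run of the weight updates on the clients with index in `T`, together with a solution `(F, σ)`
for these clients all of whose cost terms are at most `1`. -/
structure Phase {ι : Type*} [DecidableEq ι] (m n : ℕ) (A : Finset ι) (T : Finset ℕ)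
    (E : ℕ → Finset ι) (c : ι → ℝ) (a p w : ℕ → ι → ℝ) (α : ℕ → ℝ) (S : ℕ → Finset ι)
    (F : Finset ι) (σ : ℕ → ι) : Prop where
  two_le : 2 ≤ m
  card_le : A.card ≤ m
  range : T ⊆ Finset.range n
  step : ∀ k ∈ T, WeightStep (E k) c (a k) (p k) (w k) (α k) (S k) (w (k + 1))
  skip : ∀ k < n, k ∉ T → w (k + 1) = w k
  init : ∀ i, w 0 i = 1 / m
  sub : ∀ k ∈ T, E k ⊆ A
  le_c : ∀ i, 1 / (m : ℝ) ≤ c i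
  c_le : ∀ i ∈ A, c i ≤ 2
  p_nonneg : ∀ k i, 0 ≤ p k i
  mem_E : ∀ k ∈ T, σ k ∈ E k
  mem_F : ∀ k ∈ T, σ k ∈ F
  F_sub : F ⊆ A
  sum_c : ∑ i ∈ F, c i ≤ 2
  sum_a : ∑ k ∈ T, a k (σ k) ≤ 1
  sum_p : ∀ i, ∑ k ∈ T with σ k = i, p k i ≤ 1

namespace Phase

variable {ι : Type*} [DecidableEq ι] {m n : ℕ} {A : Finset ι} {T : Finset ℕ}
    {E : ℕ → Finset ι} {c : ι → ℝ} {a p w : ℕ → ι → ℝ} {α : ℕ → ℝ} {S : ℕ → Finset ι}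
    {F : Finset ι} {σ : ℕ → ι}

theorem m_pos (h : Phase m n A T E c a p w α S F σ) : (0 : ℝ) < m := by
  have := h.two_le
  positivity

theorem c_pos (h : Phase m n A T E c a p w α S F σ) (i : ι) : 0 < c i :=
  (one_div_pos.2 h.m_pos).trans_le (h.le_c i)

theorem le_succ (h : Phase m n A T E c a p w α S F σ) {k : ℕ} (hk : k < n) (i : ι) :
    w k i ≤ w (k + 1) i := by
  by_cases hT : k ∈ T
  · exact (h.step k hT).le i
  · rw [h.skip k hk hT]

theorem mono (h : Phase m n A T E c a p w α S F σ) {j k : ℕ} (hjk : j ≤ k) (hk : k ≤ n) (i : ι) :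
    w j i ≤ w k i := by
  induction k, hjk using Nat.le_induction with
  | base => exact le_rfl
  | succ k hjk ih => exact (ih (by omega)).trans (h.le_succ (by omega) i)

theorem w_pos (h : Phase m n A T E c a p w α S F σ) {k : ℕ} (hk : k ≤ n) (i : ι) :
    0 < w k i :=
  lt_of_lt_of_le (by rw [h.init]; exact one_div_pos.2 h.m_pos) (h.mono (Nat.zero_le k) hk i)

theorem lt_of_mem (h : Phase m n A T E c a p w α S F σ) {k : ℕ} (hk : k ∈ T) : k < n :=
  Finset.mem_range.1 (h.range hk)

theorem potential_le_price (h : Phase m n A T E c a p w α S F σ) :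
    ∑ i ∈ A, c i * w n i ≤ 2 + 3 * ∑ k ∈ T, α k := by
  have h1 : ∑ k ∈ T, (∑ i ∈ A, c i * w (k + 1) i - ∑ i ∈ A, c i * w k i)
      = ∑ i ∈ A, c i * w n i - ∑ i ∈ A, c i * w 0 i :=
    sum_sub_eq_of_skip h.range (fun k => ∑ i ∈ A, c i * w k i)
      fun k hk hkT => by simp only [h.skip k hk hkT]
  have h2 : ∀ k ∈ T, ∑ i ∈ A, c i * w (k + 1) i - ∑ i ∈ A, c i * w k i ≤ 3 * α k := by
    intro k hk
    refine le_trans (le_of_eq ?_) (h.step k hk).potential_le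
    rw [← Finset.sum_sub_distrib, Finset.sum_subset (h.sub k hk) fun i _ hi => by
      rw [(h.step k hk).eq_of_notMem i hi, sub_self, mul_zero]]
    exact Finset.sum_congr rfl fun i _ => by ring
  have h3 : ∑ i ∈ A, c i * w 0 i ≤ 2 := by
    have hm := h.m_pos
    calc ∑ i ∈ A, c i * w 0 i ≤ ∑ _i ∈ A, 2 * (1 / (m : ℝ)) :=
          Finset.sum_le_sum fun i hi => by
            rw [h.init]
            exact mul_le_mul_of_nonneg_right (h.c_le i hi) (by positivity)
      _ = A.card * (2 * (1 / (m : ℝ))) := by rw [Finset.sum_const, nsmul_eq_mul]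
      _ ≤ m * (2 * (1 / (m : ℝ))) :=
          mul_le_mul_of_nonneg_right (by exact_mod_cast h.card_le) (by positivity)
      _ = 2 := by field_simp
  have h4 := Finset.sum_le_sum h2
  rw [h1, ← Finset.mul_sum] at h4
  linarith

/-- Truncation at 1 caps the logarithmic growth of each facility at log m, and the offline
facilities have total normalised cost at most 2. -/
theorem sum_growth_le (h : Phase m n A T E c a p w α S F σ) :
    ∑ k ∈ T, c (σ k) * (Real.log (min 1 (w (k + 1) (σ k))) - Real.log (min 1 (w k (σ k))))
      ≤ 2 * Real.log m := by
  have hm := h.m_pos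
  have hlogm : 0 ≤ Real.log m := Real.log_natCast_nonneg m
  have hmono : ∀ k ∈ T, ∀ i, Real.log (min 1 (w k i)) ≤ Real.log (min 1 (w (k + 1) i)) :=
    fun k hk i => Real.log_le_log (lt_min one_pos (h.w_pos (h.lt_of_mem hk).le i))
      (min_le_min le_rfl (h.le_succ (h.lt_of_mem hk) i))
  calc _ ≤ ∑ k ∈ T, ∑ i ∈ F, c i *
        (Real.log (min 1 (w (k + 1) i)) - Real.log (min 1 (w k i))) :=
        Finset.sum_le_sum fun k hk => Finset.single_le_sum
          (f := fun i => c i * (Real.log (min 1 (w (k + 1) i)) - Real.log (min 1 (w k i))))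
          (fun i _ => mul_nonneg (h.c_pos i).le (sub_nonneg.2 (hmono k hk i))) (h.mem_F k hk)
    _ = ∑ i ∈ F, c i * (Real.log (min 1 (w n i)) - Real.log (min 1 (w 0 i))) := by
        rw [Finset.sum_comm]
        refine Finset.sum_congr rfl fun i _ => ?_
        rw [← Finset.mul_sum, sum_sub_eq_of_skip h.range (fun k => Real.log (min 1 (w k i)))
          fun k hk hkT => by simp only [h.skip k hk hkT]]
    _ ≤ ∑ i ∈ F, c i * Real.log m := by
        refine Finset.sum_le_sum fun i _ => mul_le_mul_of_nonneg_left ?_ (h.c_pos i).le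
        have h1 : Real.log (min 1 (w n i)) ≤ 0 :=
          Real.log_nonpos (le_min zero_le_one (h.w_pos le_rfl i).le) (min_le_left _ _)
        have h2 : min 1 (w 0 i) = 1 / m := by
          rw [h.init]
          refine min_eq_right ?_
          rw [div_le_one hm]
          exact_mod_cast (by have := h.two_le; omega : 1 ≤ m)
        rw [h2, one_div, Real.log_inv]
        linarith
    _ ≤ 2 * Real.log m := by
        rw [← Finset.sum_mul]
        exact mul_le_mul_of_nonneg_right h.sum_c hlogm

/-- Replace weights by their final values: the offline load on each facility is at most 1, so each
is charged c i · max 1 (w n i) ≤ c i + c i · w n i at most once. The divisor 4 keeps the feedback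
from the potential below 1. -/
theorem sum_load_price_le (h : Phase m n A T E c a p w α S F σ) :
    ∑ k ∈ T, c (σ k) * max 1 (w k (σ k)) * p k (σ k) / 4
      ≤ (2 + ∑ i ∈ A, c i * w n i) / 4 := by
  have hmax : ∀ i, 0 ≤ c i * max 1 (w n i) := fun i =>
    mul_nonneg (h.c_pos i).le (zero_le_one.trans (le_max_left _ _))
  rw [← Finset.sum_div]
  refine div_le_div_of_nonneg_right ?_ (by norm_num)
  calc ∑ k ∈ T, c (σ k) * max 1 (w k (σ k)) * p k (σ k)
      ≤ ∑ k ∈ T, c (σ k) * max 1 (w n (σ k)) * p k (σ k) :=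
        Finset.sum_le_sum fun k hk => mul_le_mul_of_nonneg_right
          (mul_le_mul_of_nonneg_left (max_le_max le_rfl (h.mono (h.lt_of_mem hk).le le_rfl _))
            (h.c_pos _).le) (h.p_nonneg _ _)
    _ = ∑ i ∈ F, ∑ k ∈ T with σ k = i, c (σ k) * max 1 (w n (σ k)) * p k (σ k) :=
        (Finset.sum_fiberwise_of_maps_to h.mem_F _).symm
    _ = ∑ i ∈ F, c i * max 1 (w n i) * ∑ k ∈ T with σ k = i, p k i := by
        refine Finset.sum_congr rfl fun i _ => ?_
        rw [Finset.mul_sum]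
        exact Finset.sum_congr rfl fun k hk => by rw [(Finset.mem_filter.1 hk).2]
    _ ≤ ∑ i ∈ F, (c i + c i * w n i) := by
        refine Finset.sum_le_sum fun i _ => ?_
        refine (mul_le_of_le_one_right (hmax i) (h.sum_p i)).trans ?_
        rw [← mul_one_add]
        have hw := h.w_pos le_rfl i
        exact mul_le_mul_of_nonneg_left (max_le (by linarith) (by linarith)) (h.c_pos i).le
    _ ≤ 2 + ∑ i ∈ A, c i * w n i := by
        rw [Finset.sum_add_distrib]
        exact add_le_add h.sum_c (Finset.sum_le_sum_of_subset_of_nonneg h.F_sub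
          fun i _ _ => mul_nonneg (h.c_pos i).le (h.w_pos le_rfl i).le)

theorem price_le_potential (h : Phase m n A T E c a p w α S F σ) :
    ∑ k ∈ T, α k ≤ 1 + (2 + ∑ i ∈ A, c i * w n i) / 4 + 2 * Real.log m := by
  have h1 := Finset.sum_le_sum fun k hk => (h.step k hk).price_le (σ k) (h.mem_E k hk)
  rw [Finset.sum_add_distrib, Finset.sum_add_distrib] at h1
  linarith [h.sum_a, h.sum_load_price_le, h.sum_growth_le]

/-- The two inequalities combine to Φ ≤ 2 + 3(3/2 + Φ/4 + 2 log m), which is solved for Φ. -/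
theorem potential_bound (h : Phase m n A T E c a p w α S F σ) :
    ∑ i ∈ A, c i * w n i ≤ 26 + 24 * Real.log m := by
  linarith [h.potential_le_price, h.price_le_potential]

theorem price_bound (h : Phase m n A T E c a p w α S F σ) :
    ∑ k ∈ T, α k ≤ 8 + 8 * Real.log m := by
  linarith [h.potential_bound, h.price_le_potential]

/-- Each client with i in its server set raises log (w i) by at least p/8, and this logarithm moves
only from -log m to at most 8 log m; hence 72 = 8 · 9. -/
theorem load_bound (h : Phase m n A T E c a p w α S F σ) (i : ι) :
    ∑ k ∈ T with i ∈ S k, p k i ≤ 72 * Real.log m := by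
  have hm := h.m_pos
  have hm2 : (2 : ℝ) ≤ m := by exact_mod_cast h.two_le
  have hlogm : 0 ≤ Real.log m := Real.log_natCast_nonneg m
  by_cases hiA : i ∈ A
  · have h1 : ∑ k ∈ T with i ∈ S k, p k i / 8 ≤ Real.log (w n i) - Real.log (w 0 i) := by
      rw [← sum_sub_eq_of_skip h.range (fun k => Real.log (w k i))
          fun k hk hkT => by simp only [h.skip k hk hkT], Finset.sum_filter]
      refine Finset.sum_le_sum fun k hk => ?_
      have hwk := h.w_pos (h.lt_of_mem hk).le i
      split_ifs with hi
      · have h2 := Real.log_le_log (mul_pos hwk (Real.exp_pos _)) ((h.step k hk).mul_exp_le i hi)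
        rw [Real.log_mul hwk.ne' (Real.exp_pos _).ne', Real.log_exp] at h2
        linarith
      · exact sub_nonneg.2 (Real.log_le_log hwk (h.le_succ (h.lt_of_mem hk) i))
    have h2 : c i * w n i ≤ 26 + 24 * Real.log m :=
      (Finset.single_le_sum (f := fun i => c i * w n i)
        (fun i _ => mul_nonneg (h.c_pos i).le (h.w_pos le_rfl i).le) hiA).trans h.potential_bound
    -- The floor 1/m on c i turns the potential bound into a polynomial weight bound; 2 ≤ m later
    -- absorbs the constant 2 ^ 6.
    have h3 : w n i ≤ 2 ^ 6 * (m : ℝ) ^ 2 := by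
      have h4 : 1 / (m : ℝ) * w n i ≤ c i * w n i :=
        mul_le_mul_of_nonneg_right (h.le_c i) (h.w_pos le_rfl i).le
      have h5 : Real.log m ≤ m := (Real.log_le_sub_one_of_pos hm).trans (by linarith)
      have h6 : 1 / (m : ℝ) * w n i ≤ 64 * m := by linarith
      rw [one_div_mul_eq_div, div_le_iff₀ hm] at h6
      linarith
    have h4 : Real.log (w n i) ≤ 8 * Real.log m := by
      calc Real.log (w n i) ≤ Real.log ((m : ℝ) ^ 8) := by
            refine Real.log_le_log (h.w_pos le_rfl i) (h3.trans ?_)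
            calc (2 : ℝ) ^ 6 * (m : ℝ) ^ 2 ≤ (m : ℝ) ^ 6 * (m : ℝ) ^ 2 := by gcongr
              _ = (m : ℝ) ^ 8 := by ring
        _ = 8 * Real.log m := by rw [Real.log_pow]; norm_num
    rw [h.init, one_div, Real.log_inv, ← Finset.sum_div] at h1
    linarith
  · rw [Finset.filter_false_of_mem fun k hk hi => hiA (h.sub k hk ((h.step k hk).subset hi))]
    simpa using hlogm

end Phase

/-! ### Rounding the guesses to powers of two -/

/-- The least power of two that is at least `x`, for `0 < x < ∞`. -/
noncomputable def roundUp (x : ℝ≥0∞) : ℝ≥0∞ :=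
  if h : x ≠ 0 ∧ x ≠ ⊤ then
    2 ^ ((ENNReal.exists_mem_Ioc_zpow h.1 h.2 ENNReal.one_lt_two ENNReal.ofNat_ne_top).choose + 1)
  else x

theorem roundUp_spec (x : ℝ≥0∞) :
    x ≤ roundUp x ∧ roundUp x ≤ 2 * x ∧
      (roundUp x = 0 ∨ roundUp x = ⊤ ∨ ∃ z : ℤ, roundUp x = 2 ^ z) := by
  unfold roundUp
  split_ifs with h
  · set h' := ENNReal.exists_mem_Ioc_zpow h.1 h.2 ENNReal.one_lt_two ENNReal.ofNat_ne_top
    have hs := h'.choose_spec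
    refine ⟨hs.2, ?_, Or.inr (Or.inr ⟨_, rfl⟩)⟩
    rw [ENNReal.zpow_add two_ne_zero ENNReal.ofNat_ne_top, zpow_one, mul_comm]
    exact mul_le_mul_right hs.1.le 2
  · refine ⟨le_rfl, le_mul_of_one_le_left' ENNReal.one_lt_two.le, ?_⟩
    by_cases h0 : x = 0
    · exact Or.inl h0
    · exact Or.inr (Or.inl (by tauto))

theorem two_mul_le_of_lt_roundUp {x y : ℝ≥0∞} (h : roundUp x < roundUp y) :
    2 * roundUp x ≤ roundUp y := by
  rcases (roundUp_spec x).2.2 with h0 | h0 | ⟨a, ha⟩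
  · rw [h0]; simp
  · rw [h0] at h; exact absurd h not_top_lt
  rcases (roundUp_spec y).2.2 with h0 | h0 | ⟨b, hb⟩
  · rw [h0] at h; exact absurd h not_lt_zero
  · rw [h0]; exact le_top
  rw [ha, hb] at h ⊢
  have hab : a < b := by
    by_contra! hle
    exact absurd h (not_lt.2 (ENNReal.zpow_le_of_le ENNReal.one_lt_two.le hle))
  calc (2 : ℝ≥0∞) * 2 ^ a = 2 ^ (a + 1) := by
        rw [ENNReal.zpow_add two_ne_zero ENNReal.ofNat_ne_top, zpow_one, mul_comm]
    _ ≤ 2 ^ b := ENNReal.zpow_le_of_le ENNReal.one_lt_two.le hab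

/-- Below the maximum a, all elements are at most a / 2, so inductively they sum to at most a. -/
theorem sum_le_two_mul_of_doubling (V : Finset ℝ≥0∞)
    (hV : ∀ x ∈ V, ∀ y ∈ V, x < y → 2 * x ≤ y) (B : ℝ≥0∞) (hB : ∀ x ∈ V, x ≤ B) :
    ∑ x ∈ V, x ≤ 2 * B := by
  induction V using Finset.induction_on_max generalizing B with
  | empty => simp
  | insert a s hs ih =>
    rw [Finset.sum_insert fun h => lt_irrefl _ (hs a h)]
    have h1 := ih (fun x hx y hy => hV x (Finset.mem_insert_of_mem hx) y
      (Finset.mem_insert_of_mem hy)) (a / 2) fun x hx => by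
        rw [ENNReal.le_div_iff_mul_le (Or.inl two_ne_zero) (Or.inl ENNReal.ofNat_ne_top), mul_comm]
        exact hV x (Finset.mem_insert_of_mem hx) a (Finset.mem_insert_self _ _) (hs x hx)
    rw [ENNReal.mul_div_cancel two_ne_zero ENNReal.ofNat_ne_top] at h1
    calc a + ∑ x ∈ s, x ≤ a + a := add_le_add le_rfl h1
      _ = 2 * a := (two_mul a).symm
      _ ≤ 2 * B := mul_le_mul_right (hB a (Finset.mem_insert_self _ _)) 2

/-! ### Offline optima of prefixes -/

variable {m : ℕ}

theorem exists_cost_eq_opt [NeZero m] {n : ℕ} (c : Fin m → ℝ≥0∞) (client : Fin n → Client m) :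
    ∃ (F : Finset (Fin m)) (σ : Fin n → Fin m), (∀ j, σ j ∈ F) ∧
      cost c client F σ = opt c client := by
  let X := {q : Finset (Fin m) × (Fin n → Fin m) // ∀ j, q.2 j ∈ q.1}
  have : Nonempty X := ⟨⟨(Finset.univ, fun _ => 0), fun _ => Finset.mem_univ _⟩⟩
  obtain ⟨q, hq⟩ := Finite.exists_min fun q : X => cost c client q.1.1 q.1.2
  refine ⟨q.1.1, q.1.2, q.2, le_antisymm ?_ ?_⟩
  · exact le_iInf fun F => le_iInf fun σ => le_iInf fun h => hq ⟨(F, σ), h⟩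
  · exact iInf_le_of_le _ (iInf_le_of_le _ (iInf_le_of_le q.2 le_rfl))

theorem opt_upTo_le {n : ℕ} (c : Fin m → ℝ≥0∞) (client : Fin n → Client m) (j : Fin n) :
    opt c (upTo client j) ≤ opt c client := by
  refine le_iInf fun F => le_iInf fun σ => le_iInf fun h => ?_
  refine iInf_le_of_le F (iInf_le_of_le (fun l => σ (l.castLE j.isLt))
    (iInf_le_of_le (fun l => h _) ?_))
  have hinj : Function.Injective fun l : Fin (j.val + 1) => (l.castLE j.isLt : Fin n) :=
    Fin.castLE_injective _
  unfold cost
  refine add_le_add (add_le_add le_rfl ?_) (iSup_mono fun i => ?_)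
  · calc ∑ l, (upTo client j l).assignCost (σ (l.castLE j.isLt))
        = ∑ k ∈ Finset.univ.image fun l : Fin (j.val + 1) => (l.castLE j.isLt : Fin n),
          (client k).assignCost (σ k) :=
        (Finset.sum_image (f := fun k => (client k).assignCost (σ k))
          fun _ _ _ _ h => hinj h).symm
      _ ≤ _ := Finset.sum_le_sum_of_subset (Finset.subset_univ _)
  · calc ∑ l with σ (l.castLE j.isLt) = i, (upTo client j l).load i
        = ∑ k ∈ (Finset.univ.filter fun l : Fin (j.val + 1) => σ (l.castLE j.isLt) = i).image
            fun l : Fin (j.val + 1) => (l.castLE j.isLt : Fin n),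
          (client k).load i :=
        (Finset.sum_image (f := fun k => (client k).load i) fun _ _ _ _ h => hinj h).symm
      _ ≤ _ := Finset.sum_le_sum_of_subset fun k hk => by
        obtain ⟨l, hl, rfl⟩ := Finset.mem_image.1 hk
        exact Finset.mem_filter.2 ⟨Finset.mem_univ _, (Finset.mem_filter.1 hl).2⟩

/-! ### The online algorithm -/

/-- The optimum of the clients `0, …, k` of an infinite sequence. -/
noncomputable def prefixOpt (c : Fin m → ℝ≥0∞) (s : ℕ → Client m) (k : ℕ) : ℝ≥0∞ :=
  opt c fun l : Fin (k + 1) => s l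

/-- The estimate of the optimum that is used when client `k` is served. -/
noncomputable def budget (c : Fin m → ℝ≥0∞) (s : ℕ → Client m) (k : ℕ) : ℝ≥0∞ :=
  roundUp (prefixOpt c s k)

/-- The summand 1/m keeps weights polynomially bounded, and contributes at most 1 in total over all
facilities. -/
noncomputable def normCost (c : Fin m → ℝ≥0∞) (Z : ℝ≥0∞) (i : Fin m) : ℝ :=
  (c i / Z).toReal + 1 / m

/-- The facilities all of whose costs for the client `x` are within the budget `Z`. -/
noncomputable def feasible (c : Fin m → ℝ≥0∞) (Z : ℝ≥0∞) (x : Client m) : Finset (Fin m) :=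
  {i | c i ≤ Z ∧ x.assignCost i ≤ Z ∧ x.load i ≤ Z}

open Classical in
/-- The price, the set of servers and the new weights for the client `x` under budget `Z`. -/
noncomputable def update (c : Fin m → ℝ≥0∞) (Z : ℝ≥0∞) (x : Client m) (w : Fin m → ℝ) :
    ℝ × Finset (Fin m) × (Fin m → ℝ) :=
  if h : ∃ r : ℝ × Finset (Fin m) × (Fin m → ℝ),
      WeightStep (feasible c Z x) (normCost c Z) (fun i => (x.assignCost i / Z).toReal)
        (fun i => (x.load i / Z).toReal) w r.1 r.2.1 r.2.2
  then h.choose else (0, ∅, w)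

open Classical in
/-- The facility weights of the instance with budget `Z` before client `k` arrives. That instance
consists of the clients that are served with this budget. -/
noncomputable def weights (c : Fin m → ℝ≥0∞) (s : ℕ → Client m) (Z : ℝ≥0∞) : ℕ → Fin m → ℝ
  | 0 => fun _ => 1 / m
  | k + 1 => if budget c s k = Z then (update c Z (s k) (weights c s Z k)).2.2
      else weights c s Z k

noncomputable def currentUpdate (c : Fin m → ℝ≥0∞) (s : ℕ → Client m) (k : ℕ) :
    ℝ × Finset (Fin m) × (Fin m → ℝ) :=
  update c (budget c s k) (s k) (weights c s (budget c s k) k)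

/-- Here k + 1 stands in for the unknown n, and the factor 2 makes the failure probabilities
summable. -/
noncomputable def rate (m k : ℕ) : ℝ := 2 * Real.log (m * (k + 1))

/-- The servers of client `k` whose threshold `θ i` is exceeded. -/
noncomputable def sampled (c : Fin m → ℝ≥0∞) (s : ℕ → Client m) (k : ℕ) (θ : Fin m → ℝ) :
    Finset (Fin m) :=
  {i ∈ (currentUpdate c s k).2.1 | θ i < rate m k * (currentUpdate c s k).2.2 i}

open Classical in
noncomputable def fallback [NeZero m] (c : Fin m → ℝ≥0∞) (s : ℕ → Client m) (k : ℕ) : Fin m :=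
  if h : (feasible c (budget c s k) (s k)).Nonempty then h.choose else 0

open Classical in
noncomputable def openRule (O : Finset (Fin m)) (i : Fin m) : Finset (Fin m) :=
  if O.Nonempty then O else {i}

open Classical in
noncomputable def assignRule (O : Finset (Fin m)) (i : Fin m) : Fin m :=
  if h : O.Nonempty then h.choose else i

theorem assignRule_mem_openRule (O : Finset (Fin m)) (i : Fin m) :
    assignRule O i ∈ openRule O i := by
  unfold assignRule openRule
  split_ifs with h
  · exact h.choose_spec
  · exact Finset.mem_singleton_self i

/-- The padding is harmless: decisions for client k depend only on clients up to k, as the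
congruence lemmas below show. -/
noncomputable def extend {n : ℕ} (client : Fin n → Client m) (l : ℕ) : Client m :=
  if h : l < n then client ⟨l, h⟩ else ⟨0, 0⟩

theorem extend_coe {n : ℕ} (client : Fin n → Client m) (j : Fin n) :
    extend client j = client j := dif_pos j.isLt

theorem extend_upTo {n : ℕ} (client : Fin n → Client m) (j : Fin n) {l : ℕ} (hl : l ≤ j) :
    extend (upTo client j) l = extend client l := by
  unfold extend
  rw [dif_pos (by omega), dif_pos (by omega)]
  rfl

theorem prefixOpt_extend {n : ℕ} (c : Fin m → ℝ≥0∞) (client : Fin n → Client m) (j : Fin n) :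
    prefixOpt c (extend client) j = opt c (upTo client j) := by
  unfold prefixOpt
  congr 1
  funext l
  exact extend_coe client (l.castLE j.isLt)

section congr

variable {c : Fin m → ℝ≥0∞} {s t : ℕ → Client m}

theorem budget_congr {k : ℕ} (h : ∀ l ≤ k, s l = t l) : budget c s k = budget c t k := by
  unfold budget prefixOpt
  congr 2
  funext l
  exact h l (by omega)

theorem weights_congr {k : ℕ} (Z : ℝ≥0∞) (h : ∀ l < k, s l = t l) :
    weights c s Z k = weights c t Z k := by
  induction k with
  | zero => rfl
  | succ k ih =>
    unfold weights
    rw [budget_congr fun l hl => h l (by omega), ih fun l hl => h l (by omega), h k (by omega)]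

theorem currentUpdate_congr {k : ℕ} (h : ∀ l ≤ k, s l = t l) :
    currentUpdate c s k = currentUpdate c t k := by
  unfold currentUpdate
  rw [budget_congr h, h k le_rfl, weights_congr _ fun l hl => h l hl.le]

theorem sampled_congr {k : ℕ} (h : ∀ l ≤ k, s l = t l) : sampled c s k = sampled c t k := by
  unfold sampled
  rw [currentUpdate_congr h]

theorem fallback_congr [NeZero m] {k : ℕ} (h : ∀ l ≤ k, s l = t l) :
    fallback c s k = fallback c t k := by
  unfold fallback
  rw [budget_congr h, h k le_rfl]

end congr

/-- The online algorithm with thresholds `θ`. -/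
noncomputable def thresholdAlgorithm [NeZero m] (θ : Fin m → ℝ) : OnlineAlgorithm m where
  opens c k client := openRule (sampled c (extend client) k θ) (fallback c (extend client) k)
  assign c k client := assignRule (sampled c (extend client) k θ) (fallback c (extend client) k)
  assign_open _ k _ := ⟨Fin.last k, assignRule_mem_openRule _ _⟩

theorem openedSet_thresholdAlgorithm [NeZero m] (θ : Fin m → ℝ) {n : ℕ} (c : Fin m → ℝ≥0∞)
    (client : Fin n → Client m) :
    (thresholdAlgorithm θ).openedSet c client = Finset.univ.biUnion fun j : Fin n =>
      openRule (sampled c (extend client) j θ) (fallback c (extend client) j) := by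
  unfold OnlineAlgorithm.openedSet thresholdAlgorithm
  congr 1
  funext j
  have h : ∀ l ≤ j.val, extend (upTo client j) l = extend client l :=
    fun l hl => extend_upTo client j hl
  simp only [sampled_congr h, fallback_congr h]

theorem assignment_thresholdAlgorithm [NeZero m] (θ : Fin m → ℝ) {n : ℕ} (c : Fin m → ℝ≥0∞)
    (client : Fin n → Client m) (j : Fin n) :
    (thresholdAlgorithm θ).assignment c client j =
      assignRule (sampled c (extend client) j θ) (fallback c (extend client) j) := by
  have h : ∀ l ≤ j.val, extend (upTo client j) l = extend client l :=
    fun l hl => extend_upTo client j hl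
  unfold OnlineAlgorithm.assignment thresholdAlgorithm
  simp only [sampled_congr h, fallback_congr h]

/-! ### Random thresholds -/

/-- The uniform distribution on the unit interval. -/
noncomputable def uniform : MeasureTheory.Measure ℝ :=
  MeasureTheory.volume.restrict (Set.Icc 0 1)

instance : MeasureTheory.IsProbabilityMeasure uniform :=
  ⟨by simp [uniform]⟩

/-- The sampled set takes finitely many values, each on a measurable event. -/
theorem measurableSet_sampled (c : Fin m → ℝ≥0∞) (s : ℕ → Client m) (k : ℕ)
    (Q : Finset (Fin m) → Prop) : MeasurableSet {θ | Q (sampled c s k θ)} := by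
  classical
  have h1 : ∀ i, MeasurableSet {θ | i ∈ sampled c s k θ} := fun i => by
    unfold sampled
    simp only [Finset.mem_filter]
    exact (MeasurableSet.const _).inter
      (measurableSet_lt (measurable_pi_apply i) measurable_const)
  have h2 : ∀ U, MeasurableSet {θ | sampled c s k θ = U} := fun U => by
    have : {θ | sampled c s k θ = U} = ⋂ i, {θ | i ∈ sampled c s k θ ↔ i ∈ U} := by
      ext θ
      simp [Finset.ext_iff]
    rw [this]
    exact MeasurableSet.iInter fun i => (h1 i).iff (MeasurableSet.const _)
  have : {θ | Q (sampled c s k θ)} = ⋃ U ∈ {U | Q U}, {θ | sampled c s k θ = U} := by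
    ext θ
    simp
  rw [this]
  exact MeasurableSet.biUnion (Set.to_countable _) fun U _ => h2 U

noncomputable def randomAlgorithm (m : ℕ) [NeZero m] : RandomizedOnlineAlgorithm m where
  Ω := Fin m → ℝ
  μ := MeasureTheory.Measure.pi fun _ => uniform
  alg := thresholdAlgorithm
  measurableSet_opens c k client i :=
    measurableSet_sampled c _ k fun O => i ∈ openRule O (fallback c (extend client) k)
  measurableSet_assign c k client i :=
    measurableSet_sampled c _ k fun O => assignRule O (fallback c (extend client) k) = i

theorem uniform_Iio_le (t : ℝ) : uniform (Set.Iio t) ≤ ENNReal.ofReal t := by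
  rw [uniform, MeasureTheory.Measure.restrict_apply measurableSet_Iio]
  refine (MeasureTheory.measure_mono (t := Set.Icc 0 t) fun x hx =>
    ⟨hx.2.1, (Set.mem_Iio.1 hx.1).le⟩).trans ?_
  simp

theorem uniform_Ici_le (t : ℝ) : uniform (Set.Ici t) ≤ ENNReal.ofReal (Real.exp (-t)) := by
  rw [uniform, MeasureTheory.Measure.restrict_apply measurableSet_Ici]
  refine (MeasureTheory.measure_mono (t := Set.Icc t 1) fun x hx => ⟨hx.1, hx.2.2⟩).trans ?_
  rw [Real.volume_Icc]
  exact ENNReal.ofReal_le_ofReal (by linarith [Real.add_one_le_exp (-t)])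

theorem pi_uniform_lt_le (i : Fin m) (t : ℝ) :
    MeasureTheory.Measure.pi (fun _ : Fin m => uniform) {θ | θ i < t} ≤ ENNReal.ofReal t := by
  have h := (MeasureTheory.measurePreserving_eval (fun _ : Fin m => uniform) i).measure_preimage
    (measurableSet_Iio (a := t)).nullMeasurableSet
  exact (h.trans_le (uniform_Iio_le t))

/-- Thresholds are independent, and each factor is bounded through 1 - t ≤ exp (-t). -/
theorem pi_uniform_forall_le (S : Finset (Fin m)) (t : Fin m → ℝ) :
    MeasureTheory.Measure.pi (fun _ : Fin m => uniform) {θ | ∀ i ∈ S, t i ≤ θ i}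
      ≤ ENNReal.ofReal (Real.exp (-∑ i ∈ S, t i)) := by
  classical
  have : {θ : Fin m → ℝ | ∀ i ∈ S, t i ≤ θ i}
      = Set.univ.pi fun i => if i ∈ S then Set.Ici (t i) else Set.univ := by
    ext θ
    simp only [Set.mem_ofPred_eq, Set.mem_pi, Set.mem_univ, true_imp_iff]
    refine forall_congr' fun i => ?_
    split_ifs with h <;> simp [h]
  rw [this, MeasureTheory.Measure.pi_pi]
  calc _ ≤ ∏ i, if i ∈ S then ENNReal.ofReal (Real.exp (-t i)) else 1 :=
        Finset.prod_le_prod' fun i _ => by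
          split_ifs
          · exact uniform_Ici_le _
          · exact MeasureTheory.prob_le_one
    _ = _ := by
        rw [Finset.prod_ite_mem, Finset.univ_inter,
          ← ENNReal.ofReal_prod_of_nonneg fun i _ => (Real.exp_pos _).le, ← Real.exp_sum,
          Finset.sum_neg_distrib]

/-! ### Normalisation and the phases of the algorithm -/

theorem sum_toReal_div_le_one {ι : Type*} (T : Finset ι) (f : ι → ℝ≥0∞) {Z : ℝ≥0∞}
    (h : ∑ i ∈ T, f i ≤ Z) : ∑ i ∈ T, (f i / Z).toReal ≤ 1 := by
  have h1 : ∑ i ∈ T, f i / Z ≤ 1 := by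
    simp only [div_eq_mul_inv]
    rw [← Finset.sum_mul, ← div_eq_mul_inv]
    exact ENNReal.div_le_of_le_mul (by simpa using h)
  rw [← ENNReal.toReal_sum fun i hi =>
    ((Finset.single_le_sum (f := fun i => f i / Z) (fun _ _ => zero_le) hi).trans_lt
      (h1.trans_lt ENNReal.one_lt_top)).ne]
  exact ENNReal.toReal_le_of_le_ofReal zero_le_one (by simpa using h1)

theorem toReal_div_le_one {x Z : ℝ≥0∞} (h : x ≤ Z) : (x / Z).toReal ≤ 1 := by
  simpa using sum_toReal_div_le_one {()} (fun _ => x) (by simpa using h)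

theorem le_mul_ofReal_of_toReal_div_le {x Z : ℝ≥0∞} (h : x ≤ Z) (hZ : Z ≠ ⊤) {r : ℝ}
    (hr : (x / Z).toReal ≤ r) : x ≤ Z * ENNReal.ofReal r := by
  by_cases h0 : Z = 0
  · rw [h0] at h
    exact h.trans zero_le
  have h1 : x / Z ≠ ⊤ := ENNReal.div_ne_top (ne_top_of_le_ne_top hZ h) h0
  calc x = Z * (x / Z) := (ENNReal.mul_div_cancel h0 hZ).symm
    _ = Z * ENNReal.ofReal (x / Z).toReal := by rw [ENNReal.ofReal_toReal h1]
    _ ≤ Z * ENNReal.ofReal r := mul_le_mul_right (ENNReal.ofReal_le_ofReal hr) Z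

theorem normCost_pos [NeZero m] (c : Fin m → ℝ≥0∞) (Z : ℝ≥0∞) (i : Fin m) :
    0 < normCost c Z i :=
  add_pos_of_nonneg_of_pos ENNReal.toReal_nonneg
    (one_div_pos.2 (by exact_mod_cast NeZero.pos m))

theorem le_update (c : Fin m → ℝ≥0∞) (Z : ℝ≥0∞) (x : Client m) (w : Fin m → ℝ) (i : Fin m) :
    w i ≤ (update c Z x w).2.2 i := by
  unfold update
  split_ifs with h
  · exact h.choose_spec.le i
  · exact le_rfl

theorem weightStep_update [NeZero m] (c : Fin m → ℝ≥0∞) (Z : ℝ≥0∞) (x : Client m)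
    (w : Fin m → ℝ) (hw : ∀ i, 0 < w i) (hE : (feasible c Z x).Nonempty) :
    WeightStep (feasible c Z x) (normCost c Z) (fun i => (x.assignCost i / Z).toReal)
      (fun i => (x.load i / Z).toReal) w (update c Z x w).1 (update c Z x w).2.1
      (update c Z x w).2.2 := by
  have h : ∃ r : ℝ × Finset (Fin m) × (Fin m → ℝ),
      WeightStep (feasible c Z x) (normCost c Z) (fun i => (x.assignCost i / Z).toReal)
        (fun i => (x.load i / Z).toReal) w r.1 r.2.1 r.2.2 := by
    obtain ⟨α, S, w', h⟩ := exists_weightStep (feasible c Z x) hE (normCost c Z)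
      (fun i => (x.assignCost i / Z).toReal) (fun i => (x.load i / Z).toReal) w
      (normCost_pos c Z) hw (fun _ _ => ENNReal.toReal_nonneg)
      (fun i hi => ⟨ENNReal.toReal_nonneg,
        toReal_div_le_one (Finset.mem_filter.1 hi).2.2.2⟩)
    exact ⟨(α, S, w'), h⟩
  unfold update
  rw [dif_pos h]
  exact h.choose_spec

theorem weights_pos [NeZero m] (c : Fin m → ℝ≥0∞) (s : ℕ → Client m) (Z : ℝ≥0∞) (k : ℕ)
    (i : Fin m) : 0 < weights c s Z k i := by
  induction k with
  | zero => exact one_div_pos.2 (by exact_mod_cast NeZero.pos m)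
  | succ k ih =>
    unfold weights
    split_ifs
    · exact ih.trans_le (le_update _ _ _ _ _)
    · exact ih

theorem weights_succ (c : Fin m → ℝ≥0∞) (s : ℕ → Client m) (k : ℕ) :
    weights c s (budget c s k) (k + 1) = (currentUpdate c s k).2.2 := by
  rw [weights, if_pos rfl]
  rfl

open Classical in
/-- The clients among `0, …, n - 1` that are served with budget `Z`. -/
noncomputable def served (c : Fin m → ℝ≥0∞) (s : ℕ → Client m) (n : ℕ) (Z : ℝ≥0∞) : Finset ℕ :=
  {k ∈ Finset.range n | budget c s k = Z}

/-- The comparison solution is an offline optimum for the prefix ending at the last client K of the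
phase. That prefix contains the whole phase, and its optimum is at most the budget of K, which is Z.
-/
theorem exists_phase [NeZero m] (hm : 2 ≤ m) (c : Fin m → ℝ≥0∞) (s : ℕ → Client m) (n : ℕ)
    (Z : ℝ≥0∞) (hT : (served c s n Z).Nonempty) :
    ∃ F σ, Phase m n {i | c i ≤ Z} (served c s n Z) (fun k => feasible c Z (s k))
      (normCost c Z) (fun k i => ((s k).assignCost i / Z).toReal)
      (fun k i => ((s k).load i / Z).toReal) (weights c s Z) (fun k => (currentUpdate c s k).1)
      (fun k => (currentUpdate c s k).2.1) F σ := by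
  classical
  have hm0 : (0 : ℝ) < m := by exact_mod_cast NeZero.pos m
  set T := served c s n Z
  have hbT : ∀ k ∈ T, budget c s k = Z := fun k hk => (Finset.mem_filter.1 hk).2
  set K := T.max' hT
  have hlt : ∀ k ∈ T, k < K + 1 := fun k hk => Nat.lt_succ_of_le (T.le_max' k hk)
  have hTK : T ⊆ Finset.range (K + 1) := fun k hk => Finset.mem_range.2 (hlt k hk)
  obtain ⟨F', τ, hτ, hcost⟩ := exists_cost_eq_opt c fun l : Fin (K + 1) => s l
  have hle : cost c (fun l : Fin (K + 1) => s l) F' τ ≤ Z := by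
    rw [hcost, ← hbT K (T.max'_mem hT)]
    exact (roundUp_spec _).1
  unfold cost at hle
  have hle1 : ∑ i ∈ F', c i ≤ Z := le_self_add.trans (le_self_add.trans hle)
  have hle2 : ∑ l : Fin (K + 1), (s l).assignCost (τ l) ≤ Z :=
    le_add_self.trans (le_self_add.trans hle)
  have hle3 : ∀ i, ∑ l with τ l = i, (s l).load i ≤ Z := fun i =>
    (le_iSup (fun i => ∑ l with τ l = i, (s l).load i) i).trans (le_add_self.trans hle)
  set σ : ℕ → Fin m := fun k => if h : k < K + 1 then τ ⟨k, h⟩ else 0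
  have hσ : ∀ l : Fin (K + 1), σ l = τ l := fun l => dif_pos l.isLt
  have hsuma : ∑ k ∈ T, (s k).assignCost (σ k) ≤ Z := by
    refine (Finset.sum_le_sum_of_subset hTK).trans ?_
    rw [Finset.sum_range]
    simpa only [hσ] using hle2
  have hsump : ∀ i, ∑ k ∈ T with σ k = i, (s k).load i ≤ Z := fun i => by
    refine (Finset.sum_le_sum_of_subset (Finset.filter_subset_filter _ hTK)).trans ?_
    rw [Finset.sum_filter, Finset.sum_range]
    simp only [hσ]
    rw [← Finset.sum_filter]
    exact hle3 i
  have hσF : ∀ k ∈ T, σ k ∈ F' := fun k hk => by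
    rw [hσ ⟨k, hlt k hk⟩]; exact hτ _
  have hF : ∀ i ∈ F', c i ≤ Z := fun i hi =>
    (Finset.single_le_sum (fun _ _ => zero_le) hi).trans hle1
  have hfeas : ∀ k ∈ T, σ k ∈ feasible c Z (s k) := fun k hk => by
    refine Finset.mem_filter.2 ⟨Finset.mem_univ _, hF _ (hσF k hk), ?_, ?_⟩
    · exact (Finset.single_le_sum (f := fun k => (s k).assignCost (σ k))
        (fun _ _ => zero_le) hk).trans hsuma
    · exact (Finset.single_le_sum (f := fun k' => (s k').load (σ k))
        (s := T.filter fun k' => σ k' = σ k) (fun _ _ => zero_le) (Finset.mem_filter.2 ⟨hk, rfl⟩)).trans (hsump (σ k))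
  have hnorm : ∀ i ∈ Finset.univ.filter fun i => c i ≤ Z, normCost c Z i ≤ 2 := fun i hi => by
    have h1 := toReal_div_le_one (Finset.mem_filter.1 hi).2
    have h2 : 1 / (m : ℝ) ≤ 1 := by
      rw [div_le_one hm0]; exact_mod_cast NeZero.pos m
    unfold normCost
    linarith
  refine ⟨F', σ, hm, ?_, Finset.filter_subset _ _, ?_, ?_, fun _ => rfl, ?_, ?_, hnorm, ?_, hfeas,
    hσF, ?_, ?_, ?_, ?_⟩
  · exact (Finset.card_le_univ _).trans (Fintype.card_fin m).le
  · intro k hk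
    have hb := hbT k hk
    have h1 := weightStep_update c Z (s k) (weights c s Z k) (weights_pos c s Z k) ⟨_, hfeas k hk⟩
    have h2 : currentUpdate c s k = update c Z (s k) (weights c s Z k) := by
      unfold currentUpdate; rw [hb]
    have h3 : weights c s Z (k + 1) = (update c Z (s k) (weights c s Z k)).2.2 := by
      rw [weights, if_pos hb]
    rw [h2, h3]
    exact h1
  · intro k hk hkT
    rw [weights, if_neg fun h => hkT (Finset.mem_filter.2 ⟨Finset.mem_range.2 hk, h⟩)]
  · intro k _ i hi
    exact Finset.mem_filter.2 ⟨Finset.mem_univ _, (Finset.mem_filter.1 hi).2.1⟩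
  · exact fun i => le_add_of_nonneg_left ENNReal.toReal_nonneg
  · exact fun _ _ => ENNReal.toReal_nonneg
  · exact fun i hi => Finset.mem_filter.2 ⟨Finset.mem_univ _, hF i hi⟩
  · unfold normCost
    rw [Finset.sum_add_distrib, Finset.sum_const, nsmul_eq_mul]
    have h1 := sum_toReal_div_le_one F' c hle1
    have h2 : (F'.card : ℝ) * (1 / m) ≤ 1 := by
      rw [mul_one_div, div_le_one hm0]
      exact_mod_cast (Finset.card_le_univ F').trans (Fintype.card_fin m).le
    linarith
  · exact sum_toReal_div_le_one T _ hsuma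
  · exact fun i => sum_toReal_div_le_one _ _ (hsump i)

/-! ### Cost bounds for fixed thresholds -/

open Classical in
noncomputable def budgets (c : Fin m → ℝ≥0∞) (s : ℕ → Client m) (n : ℕ) : Finset ℝ≥0∞ :=
  (Finset.range n).image (budget c s)

theorem served_nonempty {c : Fin m → ℝ≥0∞} {s : ℕ → Client m} {n : ℕ} {Z : ℝ≥0∞}
    (hZ : Z ∈ budgets c s n) : (served c s n Z).Nonempty := by
  classical
  obtain ⟨k, hk, rfl⟩ := Finset.mem_image.1 hZ
  exact ⟨k, Finset.mem_filter.2 ⟨hk, rfl⟩⟩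

theorem sum_served (c : Fin m → ℝ≥0∞) (s : ℕ → Client m) (n : ℕ) (f : ℕ → ℝ≥0∞) :
    ∑ k ∈ Finset.range n, f k = ∑ Z ∈ budgets c s n, ∑ k ∈ served c s n Z, f k := by
  classical
  exact (Finset.sum_fiberwise_of_maps_to (fun k hk => Finset.mem_image_of_mem _ hk) f).symm

/-- The event that none of the servers of client `k` is open. -/
def unserved (c : Fin m → ℝ≥0∞) (s : ℕ → Client m) (k : ℕ) : Set (Fin m → ℝ) :=
  {θ | ¬ (sampled c s k θ).Nonempty}

noncomputable def failCost (c : Fin m → ℝ≥0∞) (s : ℕ → Client m) (n : ℕ) (θ : Fin m → ℝ) :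
    ℝ≥0∞ :=
  ∑ k ∈ Finset.range n, (unserved c s k).indicator (fun _ => budget c s k) θ

/-- Rates and weights only grow, so the event at the final values contains every sampling of i in
the phase; each facility is paid at most once per budget. -/
noncomputable def sampleCost (c : Fin m → ℝ≥0∞) (s : ℕ → Client m) (n : ℕ) (θ : Fin m → ℝ) :
    ℝ≥0∞ :=
  ∑ Z ∈ budgets c s n, ∑ i with c i ≤ Z,
    {θ : Fin m → ℝ | θ i < 2 * Real.log (m * n) * weights c s Z n i}.indicator (fun _ => c i) θ

theorem log_mul_succ_le {n k : ℕ} (hm : 2 ≤ m) (hk : k < n) :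
    Real.log (m * (k + 1)) ≤ Real.log (m * n) := by
  have h1 : (0 : ℝ) < m := by positivity
  refine Real.log_le_log (by positivity) (mul_le_mul_of_nonneg_left ?_ h1.le)
  exact_mod_cast hk

theorem log_mul_nonneg (m n : ℕ) : 0 ≤ Real.log (m * n) := by
  have h := Real.log_natCast_nonneg (m * n)
  push_cast at h
  exact h

theorem measurableSet_unserved (c : Fin m → ℝ≥0∞) (s : ℕ → Client m) (k : ℕ) :
    MeasurableSet (unserved c s k) :=
  measurableSet_sampled c s k fun O => ¬ O.Nonempty

theorem sum_inv_sq_le (n : ℕ) :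
    ∑ k ∈ Finset.range n, (1 : ℝ) / ((k : ℝ) + 1) ^ 2 ≤ 2 - 2 / ((n : ℝ) + 1) := by
  induction n with
  | zero => simp
  | succ n ih =>
    rw [Finset.sum_range_succ]
    have hn : (0 : ℝ) ≤ n := Nat.cast_nonneg n
    have h1 : 1 / ((n : ℝ) + 1) ^ 2 ≤ 2 / (n + 1) - 2 / (n + 1 + 1) := by
      rw [div_sub_div _ _ (by positivity) (by positivity), div_le_div_iff₀ (by positivity)
        (by positivity)]
      nlinarith [mul_nonneg hn hn]
    push_cast
    linarith

/-- The left side is of order x * y once lower terms are absorbed by x, y ≥ 1/2; the extra factor x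
on the right is slack. -/
theorem constant_bound {x y : ℝ} (hx : 1 / 2 ≤ x) (hy : 1 / 2 ≤ y) :
    4 * (8 + 8 * x + 72 * x + 2 * y * (26 + 24 * x)) + 12 ≤ 3000 * x ^ 2 * y := by
  have h1 : 0 ≤ (x - 1 / 2) * (y - 1 / 2) :=
    mul_nonneg (sub_nonneg.2 hx) (sub_nonneg.2 hy)
  have h2 : 0 ≤ x * y * (x - 1 / 2) :=
    mul_nonneg (mul_nonneg (by linarith) (by linarith)) (sub_nonneg.2 hx)
  nlinarith

section bounds

variable [NeZero m] {c : Fin m → ℝ≥0∞} {s : ℕ → Client m} {n k : ℕ}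

theorem feasible_nonempty (hm : 2 ≤ m) (c : Fin m → ℝ≥0∞) (s : ℕ → Client m) (k : ℕ) :
    (feasible c (budget c s k) (s k)).Nonempty := by
  have hk : k ∈ served c s (k + 1) (budget c s k) :=
    Finset.mem_filter.2 ⟨Finset.self_mem_range_succ k, rfl⟩
  obtain ⟨F, σ, h⟩ := exists_phase hm c s (k + 1) (budget c s k) ⟨k, hk⟩
  exact ⟨_, h.mem_E k hk⟩

theorem weightStep_currentUpdate (hm : 2 ≤ m) (c : Fin m → ℝ≥0∞) (s : ℕ → Client m) (k : ℕ) :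
    WeightStep (feasible c (budget c s k) (s k)) (normCost c (budget c s k))
      (fun i => ((s k).assignCost i / budget c s k).toReal)
      (fun i => ((s k).load i / budget c s k).toReal) (weights c s (budget c s k) k)
      (currentUpdate c s k).1 (currentUpdate c s k).2.1 (currentUpdate c s k).2.2 :=
  weightStep_update c _ (s k) _ (weights_pos c s _ k) (feasible_nonempty hm c s k)

theorem fallback_mem_feasible (hm : 2 ≤ m) (c : Fin m → ℝ≥0∞) (s : ℕ → Client m) (k : ℕ) :
    fallback c s k ∈ feasible c (budget c s k) (s k) := by
  unfold fallback
  rw [dif_pos (feasible_nonempty hm c s k)]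
  exact Exists.choose_spec _

theorem sum_openCost_le (hm : 2 ≤ m) (θ : Fin m → ℝ) :
    ∑ i ∈ Finset.univ.biUnion fun j : Fin n => openRule (sampled c s j θ) (fallback c s j), c i
      ≤ sampleCost c s n θ + failCost c s n θ := by
  classical
  set U := Finset.univ.biUnion fun j : Fin n => openRule (sampled c s j θ) (fallback c s j)
  have h1 : ∀ i ∈ U, c i ≤ (∑ Z ∈ budgets c s n, if c i ≤ Z then
      {θ : Fin m → ℝ | θ i < 2 * Real.log (m * n) * weights c s Z n i}.indicator
        (fun _ => c i) θ else 0)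
      + ∑ k ∈ Finset.range n, if fallback c s k = i then
        (unserved c s k).indicator (fun _ => budget c s k) θ else 0 := by
    intro i hi
    obtain ⟨j, -, hj⟩ := Finset.mem_biUnion.1 hi
    have hjn : j.val ∈ Finset.range n := Finset.mem_range.2 j.isLt
    by_cases hne : (sampled c s j θ).Nonempty
    · rw [openRule, if_pos hne, sampled, Finset.mem_filter] at hj
      have hstep := weightStep_currentUpdate hm c s j
      have hZ : budget c s j ∈ budgets c s n := Finset.mem_image_of_mem _ hjn
      have hci : c i ≤ budget c s j := (Finset.mem_filter.1 (hstep.subset hj.1)).2.1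
      obtain ⟨F, σ, hP⟩ := exists_phase hm c s n _ (served_nonempty hZ)
      have hθ : θ i < 2 * Real.log (m * n) * weights c s (budget c s j) n i := by
        refine hj.2.trans_le ?_
        rw [← weights_succ]
        have h0 := log_mul_nonneg m n
        exact mul_le_mul (mul_le_mul_of_nonneg_left (log_mul_succ_le hm j.isLt) two_pos.le)
          (hP.mono (Nat.succ_le_of_lt j.isLt) le_rfl i) (weights_pos _ _ _ _ _).le (by positivity)
      refine le_trans ?_ le_self_add
      refine le_trans ?_ (Finset.single_le_sum (fun _ _ => zero_le) hZ)
      rw [if_pos hci]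
      exact (Set.indicator_of_mem (s := {θ : Fin m → ℝ | θ i <
        2 * Real.log (m * n) * weights c s (budget c s j) n i}) hθ fun _ => c i).ge
    · rw [openRule, if_neg hne, Finset.mem_singleton] at hj
      refine le_trans ?_ le_add_self
      refine le_trans ?_ (Finset.single_le_sum (fun _ _ => zero_le) hjn)
      rw [if_pos hj.symm, Set.indicator_of_mem (show θ ∈ unserved c s j from hne), hj]
      exact (Finset.mem_filter.1 (fallback_mem_feasible hm c s j)).2.1
  refine (Finset.sum_le_sum h1).trans ((Finset.sum_le_sum_of_subset
    (Finset.subset_univ _)).trans (le_of_eq ?_))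
  rw [Finset.sum_add_distrib, Finset.sum_comm]
  congr 1
  · exact Finset.sum_congr rfl fun Z _ => (Finset.sum_filter _ _).symm
  · rw [Finset.sum_comm]
    exact Finset.sum_congr rfl fun k _ => by rw [Finset.sum_ite_eq, if_pos (Finset.mem_univ _)]

theorem sum_assignCost_le (hm : 2 ≤ m) (hb : ∀ k < n, budget c s k ≠ ⊤) (θ : Fin m → ℝ) :
    ∑ k ∈ Finset.range n, (s k).assignCost (assignRule (sampled c s k θ) (fallback c s k))
      ≤ ∑ Z ∈ budgets c s n, Z * ENNReal.ofReal (8 + 8 * Real.log m) + failCost c s n θ := by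
  classical
  have h1 : ∀ k ∈ Finset.range n,
      (s k).assignCost (assignRule (sampled c s k θ) (fallback c s k))
      ≤ budget c s k * ENNReal.ofReal (currentUpdate c s k).1
        + (unserved c s k).indicator (fun _ => budget c s k) θ := by
    intro k hk
    by_cases hne : (sampled c s k θ).Nonempty
    · have hstep := weightStep_currentUpdate hm c s k
      have h2 : assignRule (sampled c s k θ) (fallback c s k) ∈ (currentUpdate c s k).2.1 := by
        rw [assignRule, dif_pos hne]
        exact (Finset.mem_filter.1 hne.choose_spec).1
      refine le_trans ?_ le_self_add
      exact le_mul_ofReal_of_toReal_div_le (Finset.mem_filter.1 (hstep.subset h2)).2.2.1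
        (hb k (Finset.mem_range.1 hk)) (hstep.assign_le _ h2)
    · refine le_trans ?_ le_add_self
      rw [assignRule, dif_neg hne, Set.indicator_of_mem (show θ ∈ unserved c s k from hne)]
      exact (Finset.mem_filter.1 (fallback_mem_feasible hm c s k)).2.2.1
  refine (Finset.sum_le_sum h1).trans ?_
  rw [Finset.sum_add_distrib]
  refine add_le_add ?_ le_rfl
  rw [sum_served c s n]
  refine Finset.sum_le_sum fun Z hZ => ?_
  obtain ⟨F, σ, hP⟩ := exists_phase hm c s n Z (served_nonempty hZ)
  calc ∑ k ∈ served c s n Z, budget c s k * ENNReal.ofReal (currentUpdate c s k).1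
      = ∑ k ∈ served c s n Z, Z * ENNReal.ofReal (currentUpdate c s k).1 :=
        Finset.sum_congr rfl fun k hk => by rw [(Finset.mem_filter.1 hk).2]
    _ = Z * ENNReal.ofReal (∑ k ∈ served c s n Z, (currentUpdate c s k).1) := by
        rw [← Finset.mul_sum, ENNReal.ofReal_sum_of_nonneg fun k hk => (hP.step k hk).nonneg]
    _ ≤ _ := mul_le_mul_right (ENNReal.ofReal_le_ofReal hP.price_bound) Z

/-- Facility i is charged for every client that has it as a server, used or not. The bound thus
holds for each θ, and no concentration argument for the makespan is needed. -/
theorem sum_load_le (hm : 2 ≤ m) (hb : ∀ k < n, budget c s k ≠ ⊤) (θ : Fin m → ℝ) (i : Fin m) :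
    ∑ k ∈ Finset.range n with assignRule (sampled c s k θ) (fallback c s k) = i, (s k).load i
      ≤ ∑ Z ∈ budgets c s n, Z * ENNReal.ofReal (72 * Real.log m) + failCost c s n θ := by
  classical
  rw [Finset.sum_filter]
  have h1 : ∀ k ∈ Finset.range n,
      (if assignRule (sampled c s k θ) (fallback c s k) = i then (s k).load i else 0)
      ≤ (if i ∈ (currentUpdate c s k).2.1 then (s k).load i else 0)
        + (unserved c s k).indicator (fun _ => budget c s k) θ := by
    intro k hk
    by_cases hi : assignRule (sampled c s k θ) (fallback c s k) = i
    · rw [if_pos hi]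
      by_cases hne : (sampled c s k θ).Nonempty
      · have h2 : i ∈ (currentUpdate c s k).2.1 := by
          rw [← hi, assignRule, dif_pos hne]
          exact (Finset.mem_filter.1 hne.choose_spec).1
        rw [if_pos h2]
        exact le_self_add
      · refine le_trans ?_ le_add_self
        rw [assignRule, dif_neg hne] at hi
        rw [Set.indicator_of_mem (show θ ∈ unserved c s k from hne), ← hi]
        exact (Finset.mem_filter.1 (fallback_mem_feasible hm c s k)).2.2.2
    · rw [if_neg hi]
      exact zero_le
  refine (Finset.sum_le_sum h1).trans ?_
  rw [Finset.sum_add_distrib]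
  refine add_le_add ?_ le_rfl
  rw [sum_served c s n]
  refine Finset.sum_le_sum fun Z hZ => ?_
  obtain ⟨F, σ, hP⟩ := exists_phase hm c s n Z (served_nonempty hZ)
  rw [← Finset.sum_filter]
  calc ∑ k ∈ served c s n Z with i ∈ (currentUpdate c s k).2.1, (s k).load i
      ≤ ∑ k ∈ served c s n Z with i ∈ (currentUpdate c s k).2.1,
          Z * ENNReal.ofReal ((s k).load i / Z).toReal := by
        refine Finset.sum_le_sum fun k hk => ?_
        obtain ⟨hkT, hki⟩ := Finset.mem_filter.1 hk
        obtain ⟨hkn, rfl⟩ := Finset.mem_filter.1 hkT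
        have hstep := weightStep_currentUpdate hm c s k
        exact le_mul_ofReal_of_toReal_div_le (Finset.mem_filter.1 (hstep.subset hki)).2.2.2
          (hb k (Finset.mem_range.1 hkn)) le_rfl
    _ = Z * ENNReal.ofReal (∑ k ∈ served c s n Z with i ∈ (currentUpdate c s k).2.1,
          ((s k).load i / Z).toReal) := by
        rw [← Finset.mul_sum, ENNReal.ofReal_sum_of_nonneg fun k _ => ENNReal.toReal_nonneg]
    _ ≤ _ := mul_le_mul_right (ENNReal.ofReal_le_ofReal (hP.load_bound i)) Z

/-- A client without an open server can pay its budget three times: for opening, assignment and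
load. -/
theorem algCost_le (hm : 2 ≤ m) (c : Fin m → ℝ≥0∞) (client : Fin n → Client m)
    (hb : ∀ k < n, budget c (extend client) k ≠ ⊤) (θ : Fin m → ℝ) :
    (thresholdAlgorithm θ).algCost c client ≤
      (∑ Z ∈ budgets c (extend client) n, Z * ENNReal.ofReal (8 + 8 * Real.log m)
        + ∑ Z ∈ budgets c (extend client) n, Z * ENNReal.ofReal (72 * Real.log m))
      + (sampleCost c (extend client) n θ + 3 * failCost c (extend client) n θ) := by
  have h1 := sum_openCost_le (c := c) (s := extend client) (n := n) hm θ
  have h2 := sum_assignCost_le hm hb θ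
  have h3 := iSup_le (sum_load_le hm hb θ)
  unfold OnlineAlgorithm.algCost cost
  rw [openedSet_thresholdAlgorithm]
  simp only [assignment_thresholdAlgorithm, ← extend_coe client]
  rw [Finset.sum_range] at h2
  simp only [Finset.sum_filter] at h3 ⊢
  simp only [Finset.sum_range] at h3
  refine (add_le_add (add_le_add h1 h2) h3).trans (le_of_eq ?_)
  ring

/-! ### Expected costs -/

/-- The servers have total weight at least 1, so the exponent is at least 2 log (k + 1). -/
theorem measure_unserved_le (hm : 2 ≤ m) (c : Fin m → ℝ≥0∞) (s : ℕ → Client m) (k : ℕ) :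
    MeasureTheory.Measure.pi (fun _ : Fin m => uniform) (unserved c s k)
      ≤ ENNReal.ofReal (1 / (k + 1) ^ 2) := by
  have hstep := weightStep_currentUpdate hm c s k
  have hm1 : (1 : ℝ) ≤ m := by exact_mod_cast NeZero.pos m
  have hk1 : (1 : ℝ) ≤ k + 1 := by linarith [Nat.cast_nonneg (α := ℝ) k]
  have hlog : Real.log (k + 1) ≤ Real.log (m * (k + 1)) :=
    Real.log_le_log (by linarith) (le_mul_of_one_le_left (by linarith) hm1)
  have hlog0 : 0 ≤ Real.log ((k : ℝ) + 1) := Real.log_nonneg hk1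
  have h1 : unserved c s k ⊆ {θ | ∀ i ∈ (currentUpdate c s k).2.1,
      rate m k * (currentUpdate c s k).2.2 i ≤ θ i} := by
    intro θ hθ i hi
    by_contra! hlt
    exact hθ ⟨i, Finset.mem_filter.2 ⟨hi, hlt⟩⟩
  refine (MeasureTheory.measure_mono h1).trans ((pi_uniform_forall_le _ _).trans
    (ENNReal.ofReal_le_ofReal ?_))
  rw [← Finset.mul_sum]
  have h2 : 2 * Real.log (k + 1)
      ≤ rate m k * ∑ i ∈ (currentUpdate c s k).2.1, (currentUpdate c s k).2.2 i := by
    have h3 : rate m k = 2 * Real.log (m * (k + 1)) := rfl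
    calc 2 * Real.log (k + 1) ≤ rate m k := by rw [h3]; linarith
      _ ≤ _ := le_mul_of_one_le_right (by rw [h3]; linarith) hstep.covers
  calc _ ≤ Real.exp (-(2 * Real.log (k + 1))) := Real.exp_le_exp.2 (neg_le_neg h2)
    _ = 1 / (k + 1) ^ 2 := by
      rw [Real.exp_neg, two_mul, Real.exp_add, Real.exp_log (by linarith), one_div, sq]

theorem lintegral_failCost_le (hm : 2 ≤ m) {B : ℝ≥0∞} (hB : ∀ k < n, budget c s k ≤ B) :
    ∫⁻ θ, failCost c s n θ ∂MeasureTheory.Measure.pi (fun _ : Fin m => uniform) ≤ 2 * B := by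
  unfold failCost
  rw [MeasureTheory.lintegral_finsetSum _ fun k _ =>
    measurable_const.indicator (measurableSet_unserved c s k)]
  calc _ ≤ ∑ k ∈ Finset.range n, B * ENNReal.ofReal (1 / ((k : ℝ) + 1) ^ 2) := by
        refine Finset.sum_le_sum fun k hk => ?_
        rw [MeasureTheory.lintegral_indicator_const (measurableSet_unserved c s k)]
        exact mul_le_mul' (hB k (Finset.mem_range.1 hk)) (measure_unserved_le hm c s k)
    _ = B * ENNReal.ofReal (∑ k ∈ Finset.range n, 1 / ((k : ℝ) + 1) ^ 2) := by
        rw [← Finset.mul_sum, ENNReal.ofReal_sum_of_nonneg fun k _ => by positivity]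
    _ ≤ B * ENNReal.ofReal 2 := by
        refine mul_le_mul_right (ENNReal.ofReal_le_ofReal ((sum_inv_sq_le n).trans ?_)) B
        have : (0 : ℝ) ≤ 2 / (n + 1) := by positivity
        linarith
    _ = 2 * B := by rw [mul_comm, ENNReal.ofReal_ofNat]

/-- The opening probability is at most 2 log (m n) times the final weight, so the expectation is
controlled by the potential. -/
theorem lintegral_sampleCost_le (hm : 2 ≤ m) (hb : ∀ k < n, budget c s k ≠ ⊤) :
    ∫⁻ θ, sampleCost c s n θ ∂MeasureTheory.Measure.pi (fun _ : Fin m => uniform) ≤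
      ∑ Z ∈ budgets c s n,
        Z * ENNReal.ofReal (2 * Real.log (m * n) * (26 + 24 * Real.log m)) := by
  classical
  have hmeas : ∀ (i : Fin m) (t : ℝ), MeasurableSet {θ : Fin m → ℝ | θ i < t} := fun i t =>
    measurableSet_lt (measurable_pi_apply i) measurable_const
  have hlog := log_mul_nonneg m n
  unfold sampleCost
  rw [MeasureTheory.lintegral_finsetSum _ fun Z _ => Finset.measurable_sum _ fun i _ =>
    measurable_const.indicator (hmeas _ _)]
  refine Finset.sum_le_sum fun Z hZ => ?_
  obtain ⟨F, σ, hP⟩ := exists_phase hm c s n Z (served_nonempty hZ)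
  have hZtop : Z ≠ ⊤ := by
    obtain ⟨k, hk, rfl⟩ := Finset.mem_image.1 hZ
    exact hb k (Finset.mem_range.1 hk)
  rw [MeasureTheory.lintegral_finsetSum _ fun i _ => measurable_const.indicator (hmeas _ _)]
  have hnn : ∀ i, 0 ≤ normCost c Z i * (2 * Real.log (m * n) * weights c s Z n i) := fun i =>
    mul_nonneg (normCost_pos c Z i).le (mul_nonneg (by positivity) (weights_pos c s Z n i).le)
  calc _ ≤ ∑ i with c i ≤ Z, Z * ENNReal.ofReal
          (normCost c Z i * (2 * Real.log (m * n) * weights c s Z n i)) := by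
        refine Finset.sum_le_sum fun i hi => ?_
        rw [MeasureTheory.lintegral_indicator_const (hmeas _ _),
          ENNReal.ofReal_mul (normCost_pos c Z i).le, ← mul_assoc]
        refine mul_le_mul' (le_mul_ofReal_of_toReal_div_le (Finset.mem_filter.1 hi).2 hZtop ?_)
          (pi_uniform_lt_le i _)
        exact le_add_of_nonneg_right (by positivity)
    _ = Z * ENNReal.ofReal (2 * Real.log (m * n) *
          ∑ i with c i ≤ Z, normCost c Z i * weights c s Z n i) := by
        rw [← Finset.mul_sum, ← ENNReal.ofReal_sum_of_nonneg fun i _ => hnn i, Finset.mul_sum]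
        congr 3
        funext i
        ring
    _ ≤ _ := mul_le_mul_right (ENNReal.ofReal_le_ofReal
        (mul_le_mul_of_nonneg_left hP.potential_bound (by positivity))) Z

theorem expectedCost_randomAlgorithm_le (hm : 2 ≤ m) (c : Fin m → ℝ≥0∞)
    (client : Fin n → Client m) :
    (randomAlgorithm m).expectedCost c client ≤
      ENNReal.ofReal (3000 * Real.log m ^ 2 * Real.log (m * n)) * opt c client := by
  -- For n = 0 the bound is 0, as `Real.log 0 = 0`, so the cost must vanish exactly.
  rcases Nat.eq_zero_or_pos n with rfl | hn
  · have h : ∀ θ, (thresholdAlgorithm θ).algCost c client = 0 := fun θ => by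
      simp [OnlineAlgorithm.algCost, OnlineAlgorithm.openedSet, cost]
    refine (le_of_eq ?_).trans zero_le
    exact (MeasureTheory.lintegral_congr h).trans MeasureTheory.lintegral_zero
  have hm2 : (2 : ℝ) ≤ m := by exact_mod_cast hm
  have hn1 : (1 : ℝ) ≤ n := by exact_mod_cast hn
  have hlog2 : (1 / 2 : ℝ) ≤ Real.log 2 := by linarith [Real.log_two_gt_d9]
  have hx : 1 / 2 ≤ Real.log m := hlog2.trans (Real.log_le_log two_pos hm2)
  have hy : 1 / 2 ≤ Real.log (m * n) :=
    hlog2.trans (Real.log_le_log two_pos (by nlinarith))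
  by_cases htop : opt c client = ⊤
  · rw [htop, ENNReal.mul_top]
    · exact le_top
    · exact (ENNReal.ofReal_pos.2 (by positivity)).ne'
  set s := extend client
  set P := MeasureTheory.Measure.pi fun _ : Fin m => uniform
  have hB : ∀ k < n, budget c s k ≤ 2 * opt c client := fun k hk => by
    refine (roundUp_spec _).2.1.trans (mul_le_mul_right ?_ 2)
    exact (prefixOpt_extend c client ⟨k, hk⟩).trans_le (opt_upTo_le c client ⟨k, hk⟩)
  have hb : ∀ k < n, budget c s k ≠ ⊤ := fun k hk =>
    ne_top_of_le_ne_top (ENNReal.mul_ne_top ENNReal.ofNat_ne_top htop) (hB k hk)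
  have hsum : ∑ Z ∈ budgets c s n, Z ≤ 2 * (2 * opt c client) := by
    classical
    refine sum_le_two_mul_of_doubling _ (fun x hx y hy h => ?_) _ fun x hx => ?_
    · obtain ⟨k, -, rfl⟩ := Finset.mem_image.1 hx
      obtain ⟨l, -, rfl⟩ := Finset.mem_image.1 hy
      exact two_mul_le_of_lt_roundUp h
    · obtain ⟨k, hk, rfl⟩ := Finset.mem_image.1 hx
      exact hB k (Finset.mem_range.1 hk)
  have hmeas : Measurable fun θ => 3 * failCost c s n θ :=
    (Finset.measurable_sum _ fun k _ =>
      measurable_const.indicator (measurableSet_unserved c s k)).const_mul 3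
  calc (randomAlgorithm m).expectedCost c client
      ≤ ∫⁻ θ, ((∑ Z ∈ budgets c s n, Z * ENNReal.ofReal (8 + 8 * Real.log m)
          + ∑ Z ∈ budgets c s n, Z * ENNReal.ofReal (72 * Real.log m))
          + (sampleCost c s n θ + 3 * failCost c s n θ)) ∂P :=
        MeasureTheory.lintegral_mono fun θ => algCost_le hm c client hb θ
    _ = (∑ Z ∈ budgets c s n, Z * ENNReal.ofReal (8 + 8 * Real.log m)
          + ∑ Z ∈ budgets c s n, Z * ENNReal.ofReal (72 * Real.log m))
          + (∫⁻ θ, sampleCost c s n θ ∂P + ∫⁻ θ, 3 * failCost c s n θ ∂P) := by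
        rw [MeasureTheory.lintegral_add_left measurable_const,
          MeasureTheory.lintegral_add_right _ hmeas, MeasureTheory.lintegral_const,
          MeasureTheory.measure_univ, mul_one]
    -- The factors 3, 2, 2 are the three cost terms, the bound on ∑ 1/(k+1)², and the loss from
    -- rounding the budget.
    _ ≤ (∑ Z ∈ budgets c s n, Z * ENNReal.ofReal (8 + 8 * Real.log m)
          + ∑ Z ∈ budgets c s n, Z * ENNReal.ofReal (72 * Real.log m))
          + (∑ Z ∈ budgets c s n,
              Z * ENNReal.ofReal (2 * Real.log (m * n) * (26 + 24 * Real.log m))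
            + 3 * (2 * (2 * opt c client))) := by
        refine add_le_add le_rfl (add_le_add (lintegral_sampleCost_le hm hb) ?_)
        rw [MeasureTheory.lintegral_const_mul' _ _ ENNReal.ofNat_ne_top]
        exact mul_le_mul_right (lintegral_failCost_le hm hB) 3
    _ = (∑ Z ∈ budgets c s n, Z) * ENNReal.ofReal
          (8 + 8 * Real.log m + 72 * Real.log m + 2 * Real.log (m * n) * (26 + 24 * Real.log m))
          + 12 * opt c client := by
        rw [ENNReal.ofReal_add (p := 8 + 8 * Real.log m + 72 * Real.log m) (by positivity)
            (by positivity),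
          ENNReal.ofReal_add (p := 8 + 8 * Real.log m) (q := 72 * Real.log m) (by positivity)
            (by positivity),
          ← Finset.sum_mul, ← Finset.sum_mul, ← Finset.sum_mul]
        ring
    _ ≤ 2 * (2 * opt c client) * ENNReal.ofReal
          (8 + 8 * Real.log m + 72 * Real.log m + 2 * Real.log (m * n) * (26 + 24 * Real.log m))
          + 12 * opt c client := add_le_add (mul_le_mul_left hsum _) le_rfl
    _ = ENNReal.ofReal (4 * (8 + 8 * Real.log m + 72 * Real.log m
          + 2 * Real.log (m * n) * (26 + 24 * Real.log m)) + 12) * opt c client := by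
        rw [ENNReal.ofReal_add (q := 12) (by positivity) (by norm_num),
          ENNReal.ofReal_mul (by norm_num : (0 : ℝ) ≤ 4), ENNReal.ofReal_ofNat,
          ENNReal.ofReal_ofNat]
        ring
    _ ≤ _ := mul_le_mul_left (ENNReal.ofReal_le_ofReal (constant_bound hx hy)) _

end bounds

end CCFL

theorem mainTheorem7 :
    ∃ C : ℝ, 0 < C ∧ ∀ m : ℕ, 2 ≤ m →
      ∃ A : CCFL.RandomizedOnlineAlgorithm m,
        ∀ (openCost : Fin m → ℝ≥0∞) (n : ℕ) (client : Fin n → CCFL.Client m),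
          A.expectedCost openCost client ≤
            ENNReal.ofReal (C * Real.log m ^ 2 * Real.log (m * n)) * CCFL.opt openCost client := by
  refine ⟨3000, by norm_num, fun m hm => ?_⟩
  have : NeZero m := ⟨by omega⟩
  exact ⟨CCFL.randomAlgorithm m, fun c n client =>
    CCFL.expectedCost_randomAlgorithm_le hm c client⟩
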